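/- Let $k$ be a commutative unital $\mathbb{Q}$-algebra and $q\in k$. Let $Y=\{y_s\}_{s\ge 1}$ be an alphabet ordered by $y_1>y_2>\cdots$, let $Y^*$ be the set of words over $Y$ with the lexicographic order (a proper prefix being smaller) and empty word $1$, and let $Y^+=Y^*\setminus\{1\}$. Let $k\langle Y\rangle$ be the module of noncommutative polynomials, with the pairing for which the words are orthonormal. The $q$-stuffle product $⧢_q$ is the bilinear product on $k\langle Y\rangle$ given by $u\,⧢_q\,1=1\,⧢_q\,u=u$ and $$y_su\,⧢_q\,y_tv=y_s(u\,⧢_q\,y_tv)+y_t(y_su\,⧢_q\,v)+q\,y_{s+t}(u\,⧢_q\,v)\qquad(u,v\in Y^*).$$ Let $\pi_1,\check\pi_1$ be the linear endomorphisms of $k\langle Y\rangle$ that vanish on the empty word and satisfy, for $w\in Y^+$, $$\pi_1(w)=w+\sum_{n\ge2}\frac{(-1)^{n-1}}{n}\sum_{u_1,\dots,u_n\in Y^+}\langle w\mid u_1⧢_q\cdots⧢_q u_n\rangle\,u_1\cdots u_n,$$ $$\check\pi_1(w)=w+\sum_{n\ge2}\frac{(-1)^{n-1}}{n}\sum_{u_1,\dots,u_n\in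 Y^+}\langle w\mid u_1\cdots u_n\rangle\,u_1⧢_q\cdots⧢_q u_n.$$ A Lyndon word is a nonempty word that is smaller than each of its nonempty proper suffixes. Define $\Pi_{y}=\pi_1(y)$ for $y\in Y$; $\Pi_l=[\Pi_s,\Pi_r]=\Pi_s\Pi_r-\Pi_r\Pi_s$ for a Lyndon word $l=sr$ of length at least $2$, where $r$ is the longest proper suffix of $l$ that is a Lyndon word; and $\Pi_w=\Pi_{l_1}^{i_1}\cdots\Pi_{l_m}^{i_m}$ for a word $w=l_1^{i_1}\cdots l_m^{i_m}$ with Lyndon words $l_1>\cdots>l_m$ and $i_1,\dots,i_m\ge1$ (the Lyndon factorization of $w$). Then there is exactly one family $(\Sigma_w)_{w\in Y^*}$ in $k\langle Y\rangle$ that is dual to $(\Pi_w)_{w\in Y^*}$, that is, $\langle\Sigma_v\mid\Pi_u\rangle=\delta_{u,v}$ for all $u,v\in Y^*$, and it satisfies: 1. $\Sigma_{1}=1$. 2. For every $w=l_1^{i_1}\cdots l_m^{i_m}$ with Lyndon words $l_1>\cdots>l_m$ and $i_1,\dots,i_m\ge1$, $$\Sigma_w=\frac{1}{i_1!\cdots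 i_m!}\;\Sigma_{l_1}^{⧢_q i_1}\,⧢_q\cdots⧢_q\,\Sigma_{l_m}^{⧢_q i_m}.$$ 3. For every letter $y\in Y$, $\Sigma_y=y=\check\pi_1(y)$. -/

import Mathlib

/-! ## Words, Lyndon words and the Lyndon factorization -/

/-- The alphabet `Y = {y_s : s ≥ 1}`, with the total order `y₁ > y₂ > y₃ > ⋯`. -/
abbrev Letter : Type := ℕ+ᵒᵈ

/-- The letter `y_s`. -/
def letterY (s : ℕ+) : Letter := OrderDual.toDual s

/-- The letter `y_{s+t}` obtained from `y_s` and `y_t`. -/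
def letterAdd (a b : Letter) : Letter := letterY (OrderDual.ofDual a + OrderDual.ofDual b)

/-- Words over `Y`. The order on `Word` is Mathlib's lexicographic order on lists, in which
a proper prefix is smaller than the word. -/
abbrev Word : Type := List Letter

/-- A Lyndon word: nonempty, and smaller than each of its nonempty proper suffixes. -/
def IsLyndon (w : Word) : Prop :=
  w ≠ [] ∧ ∀ u v : Word, u ≠ [] → v ≠ [] → w = u ++ v → w < v

theorem isLyndon_singleton (a : Letter) : IsLyndon [a] := by
  refine ⟨by simp, fun u v hu hv h => ?_⟩
  have h1 := congrArg List.length h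
  have h2 := List.length_pos_iff.mpr hu
  have h3 := List.length_pos_iff.mpr hv
  simp at h1
  omega

/-- If `u < v` and `v` is no longer than `u`, then `u x < v y` for all words `x`, `y`. -/
theorem append_lt_append_of_lt_of_length_le {u v : Word} (h : u < v) (hl : v.length ≤ u.length)
    (x y : Word) : u ++ x < v ++ y := by
  induction u generalizing v with
  | nil =>
    have : v = [] := List.length_eq_zero_iff.mp (by simpa using hl)
    subst this
    exact absurd h (lt_irrefl _)
  | cons a u ih =>
    cases v with
    | nil => exact absurd h (List.not_lt_nil _)
    | cons b v =>
      rw [List.cons_append, List.cons_append, List.cons_lt_cons_iff]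
      rcases List.cons_lt_cons_iff.mp h with h | ⟨h1, h2⟩
      · exact Or.inl h
      · exact Or.inr ⟨h1, ih h2 (by simpa using hl)⟩

theorem append_lt_of_lt {u v : Word} (hu : u ≠ []) (hv : IsLyndon v) (h : u < v) :
    u ++ v < v := by
  by_cases hp : u <+: v
  · obtain ⟨t, rfl⟩ := hp
    have ht : t ≠ [] := by
      rintro rfl
      simp at h
    exact List.append_left_lt (hv.2 u t hu ht rfl)
  · clear hv hu
    suffices H : ∀ x : Word, u ++ x < v from H v
    induction u generalizing v with
    | nil => exact absurd List.nil_prefix hp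
    | cons a u ih =>
      intro x
      cases v with
      | nil => exact absurd h (List.not_lt_nil _)
      | cons b v =>
        rw [List.cons_append, List.cons_lt_cons_iff]
        rcases List.cons_lt_cons_iff.mp h with h | ⟨h1, h2⟩
        · exact Or.inl h
        · refine Or.inr ⟨h1, ih h2 (fun hp' => hp ?_) x⟩
          rw [h1, List.cons_prefix_cons]
          exact ⟨rfl, hp'⟩

/-- The concatenation of two Lyndon words `u < v` is a Lyndon word. -/
theorem IsLyndon.append {u v : Word} (hu : IsLyndon u) (hv : IsLyndon v) (h : u < v) :
    IsLyndon (u ++ v) := by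
  have hlt := append_lt_of_lt hu.1 hv h
  refine ⟨by simp [hu.1], fun x y hx hy hxy => ?_⟩
  rcases List.append_eq_append_iff.mp hxy with ⟨z, hz1, hz2⟩ | ⟨z, hz1, hz2⟩
  · rcases eq_or_ne z [] with rfl | hz
    · simp at hz2
      rw [← hz2]
      exact hlt
    · exact hlt.trans (hv.2 z y hz hy hz2)
  · rcases eq_or_ne z [] with rfl | hz
    · simp at hz2
      rw [hz2]
      exact hlt
    · rw [hz2]
      refine append_lt_append_of_lt_of_length_le (hu.2 x z hx hz hz1) ?_ v v
      rw [hz1]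
      simp

/-- Prepend a Lyndon word to a non-increasing list of Lyndon words, merging it with the
following factors as long as it is smaller than the next one. -/
def insertLyndon : Word → List Word → List Word
  | l, [] => [l]
  | l, h :: t => if l < h then insertLyndon (l ++ h) t else l :: h :: t

/-- The Lyndon factorization of a word, as its list of Lyndon factors `[u₁, …, u_n]` with
`u₁ ≥ ⋯ ≥ u_n`. -/
def lyndonFactors (w : Word) : List Word :=
  w.foldr (fun a L => insertLyndon [a] L) []

theorem insertLyndon_spec (L : List Word) : ∀ l : Word, IsLyndon l →
    (∀ u ∈ L, IsLyndon u) → L.IsChain (· ≥ ·) →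
    (∀ u ∈ insertLyndon l L, IsLyndon u) ∧ (insertLyndon l L).IsChain (· ≥ ·) ∧
      (insertLyndon l L).flatten = l ++ L.flatten := by
  induction L with
  | nil =>
    intro l hl _ _
    simpa [insertLyndon] using hl
  | cons h t ih =>
    intro l hl hL hc
    rw [insertLyndon]
    split_ifs with hlt
    · obtain ⟨h1, h2, h3⟩ := ih (l ++ h) (hl.append (hL h (by simp)) hlt)
        (fun u hu => hL u (by simp [hu])) hc.tail
      exact ⟨h1, h2, by simp [h3]⟩
    · refine ⟨?_, ?_, by simp⟩
      · intro u hu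
        rcases List.mem_cons.mp hu with rfl | hu
        · exact hl
        · exact hL u hu
      · exact List.isChain_cons_cons.mpr ⟨not_lt.mp hlt, hc⟩

/-- `lyndonFactors w` is a factorization of `w` into a non-increasing product of Lyndon words. -/
theorem lyndonFactors_spec (w : Word) :
    (∀ u ∈ lyndonFactors w, IsLyndon u) ∧ (lyndonFactors w).IsChain (· ≥ ·) ∧
      (lyndonFactors w).flatten = w := by
  induction w with
  | nil => simp [lyndonFactors]
  | cons a w ih =>
    obtain ⟨h1, h2, h3⟩ := insertLyndon_spec (lyndonFactors w) [a] (isLyndon_singleton a)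
      ih.1 ih.2.1
    exact ⟨h1, h2, h3.trans (by rw [ih.2.2]; rfl)⟩

theorem exists_lyndon_suffix (w : Word) (h : 2 ≤ w.length) :
    ∃ i, 1 ≤ i ∧ IsLyndon (w.drop i) := by
  refine ⟨w.length - 1, by omega, ?_⟩
  obtain ⟨a, ha⟩ : ∃ a, w.drop (w.length - 1) = [a] := by
    apply List.length_eq_one_iff.mp
    rw [List.length_drop]
    omega
  rw [ha]
  exact isLyndon_singleton a

open Classical in
/-- The position at which the longest proper Lyndon suffix of `w` begins. The standard
factorization of a Lyndon word `w` of length at least two is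
`(w.take i, w.drop i)` for this position `i`. -/
noncomputable def standardIndex (w : Word) (h : 2 ≤ w.length) : ℕ :=
  Nat.find (exists_lyndon_suffix w h)

theorem standardIndex_pos (w : Word) (h : 2 ≤ w.length) : 1 ≤ standardIndex w h := by
  classical
  unfold standardIndex
  exact (Nat.find_spec (exists_lyndon_suffix w h)).1

theorem standardIndex_lt (w : Word) (h : 2 ≤ w.length) : standardIndex w h < w.length := by
  classical
  unfold standardIndex
  by_contra hc
  exact (Nat.find_spec (exists_lyndon_suffix w h)).2.1 (List.drop_eq_nil_iff.mpr (not_lt.mp hc))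

/-! ## The algebra of noncommutative polynomials and the `q`-stuffle product -/

/-- The `k`-module `k⟨Y⟩` of noncommutative polynomials; its product `*` is concatenation. -/
abbrev NCPoly (k : Type*) [CommRing k] : Type _ := MonoidAlgebra k (FreeMonoid Letter)

/-- A word, seen as a polynomial. -/
noncomputable def word (k : Type*) [CommRing k] (w : Word) : NCPoly k :=
  MonoidAlgebra.single (FreeMonoid.ofList w) 1

/-- The pairing `⟨P | Q⟩ = ∑_w ⟨P | w⟩ ⟨Q | w⟩`, for which the words are orthonormal. -/
noncomputable def scal {k : Type*} [CommRing k] (P Q : NCPoly k) : k :=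
  P.coeff.sum fun w a => a * Q.coeff w

/-- The `q`-stuffle product of two words. -/
noncomputable def stuffleWord {k : Type*} [CommRing k] (q : k) : Word → Word → NCPoly k
  | [], v => word k v
  | a :: u, [] => word k (a :: u)
  | a :: u, b :: v =>
      word k [a] * stuffleWord q u (b :: v) + word k [b] * stuffleWord q (a :: u) v
        + q • (word k [letterAdd a b] * stuffleWord q u v)
termination_by u v => u.length + v.length

/-- The `q`-stuffle product of two polynomials, the bilinear extension of `stuffleWord`. -/
noncomputable def stuffle {k : Type*} [CommRing k] (q : k) (P Q : NCPoly k) : NCPoly k :=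
  P.coeff.sum fun u a => Q.coeff.sum fun v b =>
    (a * b) • stuffleWord q (FreeMonoid.toList u) (FreeMonoid.toList v)

/-- The `q`-stuffle product of a list of polynomials, `1` for the empty list. -/
noncomputable def stuffleList {k : Type*} [CommRing k] (q : k) (L : List (NCPoly k)) : NCPoly k :=
  L.foldr (stuffle q) 1

/-- The `n`-th `q`-stuffle power of a polynomial. -/
noncomputable def stufflePow {k : Type*} [CommRing k] (q : k) (P : NCPoly k) (n : ℕ) : NCPoly k :=
  stuffleList q (List.replicate n P)

/-! ## The projectors `π₁` and `π̌₁` -/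

/-- The linear endomorphism of `k⟨Y⟩` with prescribed values on the words. -/
noncomputable def linearExt {k : Type*} [CommRing k] (f : Word → NCPoly k) :
    NCPoly k →ₗ[k] NCPoly k :=
  Finsupp.linearCombination k (fun w : FreeMonoid Letter => f (FreeMonoid.toList w)) ∘ₗ
    (MonoidAlgebra.coeffLinearEquiv k).toLinearMap

/-- The sequences `(u₁, …, u_n)` of `n` nonempty words. -/
def wordSeqs (n : ℕ) : Set (List Word) := {U | U.length = n ∧ ∀ u ∈ U, u ≠ []}

open Classical in
/-- The endomorphism `π₁`; it kills the empty word, and for a nonempty word `w`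
`π₁(w) = w + ∑_{n ≥ 2} (-1)^(n-1)/n ∑_{u₁, …, u_n} ⟨w | u₁ ⧢ ⋯ ⧢ u_n⟩ u₁⋯u_n`.
Only finitely many terms of the sums are nonzero. -/
noncomputable def pi1 {k : Type*} [CommRing k] [Algebra ℚ k] (q : k) : NCPoly k →ₗ[k] NCPoly k :=
  linearExt fun w =>
    if w = [] then 0
    else word k w + ∑ᶠ n ∈ {n : ℕ | 2 ≤ n}, ((-1 : ℚ) ^ (n - 1) / (n : ℚ)) •
      ∑ᶠ U ∈ wordSeqs n, scal (word k w) (stuffleList q (U.map (word k))) • (U.map (word k)).prod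

open Classical in
/-- The adjoint endomorphism `π̌₁`; it kills the empty word, and for a nonempty word `w`
`π̌₁(w) = w + ∑_{n ≥ 2} (-1)^(n-1)/n ∑_{u₁, …, u_n} ⟨w | u₁⋯u_n⟩ u₁ ⧢ ⋯ ⧢ u_n`.
Only finitely many terms of the sums are nonzero. -/
noncomputable def piCheck1 {k : Type*} [CommRing k] [Algebra ℚ k] (q : k) :
    NCPoly k →ₗ[k] NCPoly k :=
  linearExt fun w =>
    if w = [] then 0
    else word k w + ∑ᶠ n ∈ {n : ℕ | 2 ≤ n}, ((-1 : ℚ) ^ (n - 1) / (n : ℚ)) •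
      ∑ᶠ U ∈ wordSeqs n, scal (word k w) (U.map (word k)).prod • stuffleList q (U.map (word k))

/-! ## The bases `Π` and `Σ` -/

/-- `Π_l` for a Lyndon word `l`: `Π_y = π₁(y)` for a letter `y`, and `Π_l = [Π_s, Π_r]` for
the standard factorization `(s, r)` of `l`. -/
noncomputable def PiLyndon {k : Type*} [CommRing k] [Algebra ℚ k] (q : k) (l : Word) : NCPoly k :=
  if h : 2 ≤ l.length then
    PiLyndon q (l.take (standardIndex l h)) * PiLyndon q (l.drop (standardIndex l h))
      - PiLyndon q (l.drop (standardIndex l h)) * PiLyndon q (l.take (standardIndex l h))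
  else pi1 q (word k l)
termination_by l.length
decreasing_by
  all_goals
    have h1 := standardIndex_pos l h
    have h2 := standardIndex_lt l h
    simp only [List.length_take, List.length_drop]
    omega

/-- `Π_w`, the concatenation product of the `Π_u` over the Lyndon factorization of `w`. -/
noncomputable def PiWord {k : Type*} [CommRing k] [Algebra ℚ k] (q : k) (w : Word) : NCPoly k :=
  ((lyndonFactors w).map (PiLyndon q)).prod

/-- The family `S` of polynomials is dual to the family `Π`: `⟨S_v | Π_u⟩ = δ_{u,v}`. -/
def IsDualToPi {k : Type*} [CommRing k] [Algebra ℚ k] (q : k) (S : Word → NCPoly k) : Prop :=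
  ∀ u v : Word, scal (S v) (PiWord q u) = if u = v then 1 else 0

/-- The family `Σ` obtained by duality with `Π`: the family of polynomials that is dual
to `Π`, as picked by choice. -/
noncomputable def SigmaWord {k : Type*} [CommRing k] [Algebra ℚ k] (q : k) : Word → NCPoly k :=
  Classical.epsilon (IsDualToPi q)

section Coefficients

variable {k : Type*} [CommRing k]

/-- The coefficient of a word in a noncommutative polynomial. -/
noncomputable def wordCoeff (w : Word) : NCPoly k →ₗ[k] k :=
  Finsupp.lapply (FreeMonoid.ofList w) ∘ₗ (MonoidAlgebra.coeffLinearEquiv k).toLinearMap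

theorem wordCoeff_apply (w : Word) (P : NCPoly k) :
    wordCoeff w P = P.coeff (FreeMonoid.ofList w) := rfl

theorem ncPoly_ext {P Q : NCPoly k} (h : ∀ w, wordCoeff w P = wordCoeff w Q) : P = Q :=
  MonoidAlgebra.coeff_injective (Finsupp.ext fun w => h (FreeMonoid.toList w))

open Classical in
theorem wordCoeff_word (u w : Word) : wordCoeff u (word k w) = if w = u then 1 else 0 := by
  rw [wordCoeff_apply, word, MonoidAlgebra.coeff_single, Finsupp.single_apply]
  exact if_congr Iff.rfl rfl rfl

theorem wordCoeff_word_self (w : Word) : wordCoeff w (word k w) = 1 := by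
  classical rw [wordCoeff_word, if_pos rfl]

theorem word_nil : word k [] = 1 := rfl

theorem word_append (u v : Word) : word k (u ++ v) = word k u * word k v := by
  rw [word, word, word, MonoidAlgebra.single_mul_single, mul_one, FreeMonoid.ofList_append]

theorem word_cons (a : Letter) (u : Word) : word k (a :: u) = word k [a] * word k u :=
  word_append [a] u

theorem map_word_prod (U : List Word) : (U.map (word k)).prod = word k U.flatten := by
  induction U with
  | nil => rfl
  | cons u U ih => rw [List.map_cons, List.prod_cons, ih, List.flatten_cons, word_append]

theorem ncPoly_induction {p : NCPoly k → Prop} (P : NCPoly k) (hw : ∀ w, p (word k w))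
    (hadd : ∀ P Q, p P → p Q → p (P + Q)) (hsmul : ∀ (r : k) P, p P → p (r • P)) : p P :=
  MonoidAlgebra.induction_on P (fun w => hw (FreeMonoid.toList w)) hadd hsmul

theorem ncPoly_hom_ext {M : Type*} [AddCommMonoid M] [Module k M] {f g : NCPoly k →ₗ[k] M}
    (h : ∀ w, f (word k w) = g (word k w)) : f = g := by
  refine LinearMap.ext fun P => ?_
  induction P using ncPoly_induction with
  | hw w => exact h w
  | hadd P Q hP hQ => rw [map_add, map_add, hP, hQ]
  | hsmul r P hP => rw [map_smul, map_smul, hP]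

open Classical in
theorem wordCoeff_cons_letter_mul (a c : Letter) (w : Word) (P : NCPoly k) :
    wordCoeff (c :: w) (word k [a] * P) = if a = c then wordCoeff w P else 0 := by
  induction P using ncPoly_induction with
  | hw v =>
    rw [← word_cons, wordCoeff_word, wordCoeff_word]
    simp only [List.cons.injEq]
    split_ifs <;> simp_all
  | hadd P Q hP hQ =>
    rw [mul_add, map_add, hP, hQ, map_add]
    split_ifs <;> simp
  | hsmul r P hP =>
    rw [mul_smul_comm, map_smul, hP, map_smul]
    split_ifs <;> simp

theorem wordCoeff_nil_letter_mul (a : Letter) (P : NCPoly k) :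
    wordCoeff [] (word k [a] * P) = 0 := by
  classical
  induction P using ncPoly_induction with
  | hw v =>
    rw [← word_cons, wordCoeff_word, if_neg (by simp)]
  | hadd P Q hP hQ => rw [mul_add, map_add, hP, hQ, add_zero]
  | hsmul r P hP => rw [mul_smul_comm, map_smul, hP, smul_zero]

theorem linearExt_word (f : Word → NCPoly k) (w : Word) : linearExt f (word k w) = f w := by
  simp [linearExt, word]

/-- The pairing as a bilinear form. -/
noncomputable def scalBilin : NCPoly k →ₗ[k] NCPoly k →ₗ[k] k :=
  Finsupp.lsum k (fun w : FreeMonoid Letter =>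
    (LinearMap.lsmul k (NCPoly k →ₗ[k] k)).flip (wordCoeff (FreeMonoid.toList w))) ∘ₗ
    (MonoidAlgebra.coeffLinearEquiv k).toLinearMap

theorem scal_eq_scalBilin (P Q : NCPoly k) : scal P Q = scalBilin P Q := by
  simp [scal, scalBilin, Finsupp.sum, LinearMap.sum_apply, wordCoeff_apply]

theorem scal_word_left (w : Word) (Q : NCPoly k) : scal (word k w) Q = wordCoeff w Q := by
  simp [scal, word, wordCoeff_apply]

theorem scal_word_right (P : NCPoly k) (w : Word) : scal P (word k w) = wordCoeff w P := by
  classical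
  rw [scal_eq_scalBilin]
  induction P using ncPoly_induction with
  | hw v =>
    rw [← scal_eq_scalBilin, scal_word_left, wordCoeff_word, wordCoeff_word]
    exact if_congr eq_comm rfl rfl
  | hadd P Q hP hQ => rw [map_add, LinearMap.add_apply, hP, hQ, map_add]
  | hsmul r P hP => rw [map_smul, LinearMap.smul_apply, hP, map_smul]

/-- The polynomials whose words belong to a given set. -/
noncomputable def wordSpan (k : Type*) [CommRing k] (S : Set Word) : Submodule k (NCPoly k) :=
  Submodule.span k (word k '' S)

theorem word_mem_wordSpan {S : Set Word} {w : Word} (h : w ∈ S) : word k w ∈ wordSpan k S :=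
  Submodule.subset_span ⟨w, h, rfl⟩

theorem wordSpan_mono {S T : Set Word} (h : S ⊆ T) : wordSpan k S ≤ wordSpan k T :=
  Submodule.span_mono (Set.image_mono h)

theorem eq_sum_wordCoeff (P : NCPoly k) :
    P = P.coeff.sum fun w a => a • word k (FreeMonoid.toList w) := by
  conv_lhs => rw [← MonoidAlgebra.sum_coeff_single P]
  refine Finsupp.sum_congr fun w _ => ?_
  rw [word, MonoidAlgebra.smul_single, smul_eq_mul, mul_one]
  rfl

theorem mem_wordSpan_iff {S : Set Word} {P : NCPoly k} :
    P ∈ wordSpan k S ↔ ∀ w, w ∉ S → wordCoeff w P = 0 := by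
  classical
  constructor
  · intro h w hw
    refine Submodule.span_induction ?_ (map_zero _) ?_ ?_ h
    · rintro _ ⟨v, hv, rfl⟩
      rw [wordCoeff_word, if_neg]
      rintro rfl
      exact hw hv
    · intro P Q _ _ hP hQ
      rw [map_add, hP, hQ, add_zero]
    · intro r P _ hP
      rw [map_smul, hP, smul_zero]
  · intro h
    rw [eq_sum_wordCoeff P]
    refine Submodule.sum_mem _ fun w _ => ?_
    by_cases hw : FreeMonoid.toList w ∈ S
    · exact Submodule.smul_mem _ _ (word_mem_wordSpan hw)
    · have := h _ hw
      rw [wordCoeff_apply, FreeMonoid.ofList_toList] at this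
      simp only [this, zero_smul, Submodule.zero_mem]

theorem mul_mem_wordSpan {S T R : Set Word} {P Q : NCPoly k} (hP : P ∈ wordSpan k S)
    (hQ : Q ∈ wordSpan k T) (h : ∀ u ∈ S, ∀ v ∈ T, u ++ v ∈ R) : P * Q ∈ wordSpan k R := by
  have hPQ := Submodule.mul_mem_mul hP hQ
  rw [wordSpan, wordSpan, Submodule.span_mul_span] at hPQ
  refine Submodule.span_mono ?_ hPQ
  rintro _ ⟨_, ⟨u, hu, rfl⟩, _, ⟨v, hv, rfl⟩, rfl⟩
  exact ⟨u ++ v, h u hu v hv, word_append u v⟩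

/-- The index of a letter. -/
def letterIndex (a : Letter) : ℕ := ((OrderDual.ofDual a : ℕ+) : ℕ)

theorem letterIndex_injective : Function.Injective letterIndex := fun _ _ h =>
  OrderDual.ofDual.injective (PNat.coe_injective h)

theorem letterIndex_pos (a : Letter) : 0 < letterIndex a := (OrderDual.ofDual a : ℕ+).pos

theorem letterIndex_letterAdd (a b : Letter) :
    letterIndex (letterAdd a b) = letterIndex a + letterIndex b := rfl

/-- The weight of a word, the sum of the indices of its letters. -/
def weight (w : Word) : ℕ := (w.map letterIndex).sum

theorem weight_nil : weight [] = 0 := rfl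

theorem weight_cons (a : Letter) (w : Word) :
    weight (a :: w) = letterIndex a + weight w := rfl

theorem weight_append (u v : Word) : weight (u ++ v) = weight u + weight v := by
  simp [weight]

theorem weight_singleton_injective {a b : Letter} (h : weight [a] = weight [b]) : a = b := by
  simp only [weight_cons, weight_nil, add_zero] at h
  exact letterIndex_injective h

theorem eq_nil_of_weight_eq_zero {w : Word} (h : weight w = 0) : w = [] := by
  cases w with
  | nil => rfl
  | cons a w =>
    have := letterIndex_pos a
    rw [weight_cons] at h
    omega

theorem length_le_weight (w : Word) : w.length ≤ weight w := by
  induction w with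
  | nil => exact le_rfl
  | cons a w ih =>
    have := letterIndex_pos a
    rw [weight_cons, List.length_cons]
    omega

theorem finite_weight_eq (n : ℕ) : {w : Word | weight w = n}.Finite := by
  induction n using Nat.strong_induction_on with
  | _ n ih =>
    have hfin : (⋃ m ∈ Set.Iio n, ⋃ a ∈ {a : Letter | letterIndex a ≤ n},
        (fun w : Word => a :: w) '' {w | weight w = m}).Finite := by
      refine (Set.finite_Iio n).biUnion fun m hm => Set.Finite.biUnion ?_ fun a _ =>
        (ih m hm).image _
      refine Set.Finite.of_finite_image (f := letterIndex)
        ((Set.finite_Iic n).subset ?_) ?_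
      · rintro _ ⟨a, ha, rfl⟩
        exact ha
      · intro a _ b _ h
        exact letterIndex_injective h
    refine (hfin.union (Set.finite_singleton [])).subset fun w hw => ?_
    cases w with
    | nil => exact Or.inr rfl
    | cons a w =>
      have h1 := letterIndex_pos a
      have h2 : letterIndex a + weight w = n := hw
      refine Or.inl (Set.mem_biUnion (x := weight w) (Set.mem_Iio.mpr (by omega))
        (Set.mem_biUnion (x := a) ?_ ⟨w, rfl, rfl⟩))
      exact (show letterIndex a ≤ n by omega)

end Coefficients

section Coproduct

variable {k : Type*} [CommRing k]

/-- The tensor square of `k⟨Y⟩`, as the algebra of the pairs of words. -/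
abbrev PairPoly (k : Type*) [CommRing k] : Type _ :=
  MonoidAlgebra k (FreeMonoid Letter × FreeMonoid Letter)

/-- The tensor product of two words. -/
noncomputable def pairWord (k : Type*) [CommRing k] (u v : Word) : PairPoly k :=
  MonoidAlgebra.single (FreeMonoid.ofList u, FreeMonoid.ofList v) 1

/-- The coefficient of a pair of words. -/
noncomputable def pairCoeff (u v : Word) : PairPoly k →ₗ[k] k :=
  Finsupp.lapply (FreeMonoid.ofList u, FreeMonoid.ofList v) ∘ₗ
    (MonoidAlgebra.coeffLinearEquiv k).toLinearMap

theorem pairCoeff_apply (u v : Word) (X : PairPoly k) :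
    pairCoeff u v X = X.coeff (FreeMonoid.ofList u, FreeMonoid.ofList v) := rfl

theorem pairPoly_ext {X Z : PairPoly k} (h : ∀ u v, pairCoeff u v X = pairCoeff u v Z) : X = Z :=
  MonoidAlgebra.coeff_injective
    (Finsupp.ext fun p => h (FreeMonoid.toList p.1) (FreeMonoid.toList p.2))

open Classical in
theorem pairCoeff_pairWord (u v u' v' : Word) :
    pairCoeff u v (pairWord k u' v') = if u' = u ∧ v' = v then 1 else 0 := by
  rw [pairCoeff_apply, pairWord, MonoidAlgebra.coeff_single, Finsupp.single_apply]
  exact if_congr Prod.mk_inj rfl rfl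

theorem pairWord_mul (u v u' v' : Word) :
    pairWord k u v * pairWord k u' v' = pairWord k (u ++ u') (v ++ v') := by
  rw [pairWord, pairWord, pairWord, MonoidAlgebra.single_mul_single, mul_one, Prod.mk_mul_mk,
    FreeMonoid.ofList_append, FreeMonoid.ofList_append]

theorem pairPoly_induction {p : PairPoly k → Prop} (X : PairPoly k)
    (hw : ∀ u v, p (pairWord k u v)) (hadd : ∀ P Q, p P → p Q → p (P + Q))
    (hsmul : ∀ (r : k) P, p P → p (r • P)) : p X :=
  MonoidAlgebra.induction_on X
    (fun w => hw (FreeMonoid.toList w.1) (FreeMonoid.toList w.2)) hadd hsmul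

open Classical in
theorem pairCoeff_letter_left_mul (a c : Letter) (u v : Word) (X : PairPoly k) :
    pairCoeff (c :: u) v (pairWord k [a] [] * X) = if a = c then pairCoeff u v X else 0 := by
  induction X using pairPoly_induction with
  | hw u' v' =>
    rw [pairWord_mul, pairCoeff_pairWord, pairCoeff_pairWord]
    simp only [List.cons_append, List.nil_append, List.cons.injEq]
    split_ifs <;> simp_all
  | hadd P Q hP hQ =>
    rw [mul_add, map_add, hP, hQ, map_add]
    split_ifs <;> simp
  | hsmul r P hP =>
    rw [mul_smul_comm, map_smul, hP, map_smul]
    split_ifs <;> simp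

open Classical in
theorem pairCoeff_letter_right_mul (a c : Letter) (u v : Word) (X : PairPoly k) :
    pairCoeff u (c :: v) (pairWord k [] [a] * X) = if a = c then pairCoeff u v X else 0 := by
  induction X using pairPoly_induction with
  | hw u' v' =>
    rw [pairWord_mul, pairCoeff_pairWord, pairCoeff_pairWord]
    simp only [List.cons_append, List.nil_append, List.cons.injEq]
    split_ifs <;> simp_all
  | hadd P Q hP hQ =>
    rw [mul_add, map_add, hP, hQ, map_add]
    split_ifs <;> simp
  | hsmul r P hP =>
    rw [mul_smul_comm, map_smul, hP, map_smul]
    split_ifs <;> simp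

theorem pairCoeff_nil_letter_left_mul (a : Letter) (v : Word) (X : PairPoly k) :
    pairCoeff [] v (pairWord k [a] [] * X) = 0 := by
  classical
  induction X using pairPoly_induction with
  | hw u' v' => rw [pairWord_mul, pairCoeff_pairWord, if_neg (by simp)]
  | hadd P Q hP hQ => rw [mul_add, map_add, hP, hQ, add_zero]
  | hsmul r P hP => rw [mul_smul_comm, map_smul, hP, smul_zero]

theorem pairCoeff_nil_letter_right_mul (a : Letter) (u : Word) (X : PairPoly k) :
    pairCoeff u [] (pairWord k [] [a] * X) = 0 := by
  classical
  induction X using pairPoly_induction with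
  | hw u' v' => rw [pairWord_mul, pairCoeff_pairWord, if_neg (by simp)]
  | hadd P Q hP hQ => rw [mul_add, map_add, hP, hQ, add_zero]
  | hsmul r P hP => rw [mul_smul_comm, map_smul, hP, smul_zero]

theorem pairWord_letters (a b : Letter) :
    pairWord k [a] [b] = pairWord k [a] [] * pairWord k [] [b] := by
  rw [pairWord_mul]
  rfl

/-- The embedding `P ↦ P ⊗ 1`. -/
noncomputable def tensorLeft (k : Type*) [CommRing k] : NCPoly k →ₐ[k] PairPoly k :=
  MonoidAlgebra.mapDomainAlgHom k k (MonoidHom.inl (FreeMonoid Letter) (FreeMonoid Letter))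

/-- The embedding `P ↦ 1 ⊗ P`. -/
noncomputable def tensorRight (k : Type*) [CommRing k] : NCPoly k →ₐ[k] PairPoly k :=
  MonoidAlgebra.mapDomainAlgHom k k (MonoidHom.inr (FreeMonoid Letter) (FreeMonoid Letter))

theorem tensorLeft_word (w : Word) : tensorLeft k (word k w) = pairWord k w [] := by
  simp [tensorLeft, word, pairWord]

theorem tensorRight_word (w : Word) : tensorRight k (word k w) = pairWord k [] w := by
  simp [tensorRight, word, pairWord]

theorem tensorLeft_mul_tensorRight_comm (P Q : NCPoly k) :
    tensorRight k Q * tensorLeft k P = tensorLeft k P * tensorRight k Q := by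
  induction P using ncPoly_induction with
  | hw u =>
    induction Q using ncPoly_induction with
    | hw v =>
      rw [tensorLeft_word, tensorRight_word, pairWord_mul, pairWord_mul, List.append_nil,
        List.nil_append, List.nil_append, List.append_nil]
    | hadd P Q hP hQ => rw [map_add, mul_add, add_mul, hP, hQ]
    | hsmul r P hP => rw [map_smul, smul_mul_assoc, mul_smul_comm, hP]
  | hadd P Q hP hQ => rw [map_add, mul_add, add_mul, hP, hQ]
  | hsmul r P hP => rw [map_smul, smul_mul_assoc, mul_smul_comm, hP]

theorem pairCoeff_tensorLeft_mul_tensorRight (u v : Word) (P Q : NCPoly k) :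
    pairCoeff u v (tensorLeft k P * tensorRight k Q) = wordCoeff u P * wordCoeff v Q := by
  classical
  induction P using ncPoly_induction with
  | hw u' =>
    induction Q using ncPoly_induction with
    | hw v' =>
      rw [tensorLeft_word, tensorRight_word, pairWord_mul, List.append_nil, List.nil_append,
        pairCoeff_pairWord, wordCoeff_word, wordCoeff_word]
      split_ifs <;> simp_all
    | hadd P Q hP hQ => simp only [map_add, mul_add, hP, hQ]
    | hsmul r P hP =>
      rw [map_smul, mul_smul_comm, map_smul, hP, map_smul, smul_eq_mul, smul_eq_mul]
      ring
  | hadd P Q hP hQ => simp only [map_add, add_mul, hP, hQ]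
  | hsmul r P hP =>
    rw [map_smul, smul_mul_assoc, map_smul, hP, map_smul, smul_eq_mul, smul_eq_mul]
    ring

theorem finite_letterAdd_eq (c : Letter) :
    {p : Letter × Letter | letterAdd p.1 p.2 = c}.Finite := by
  refine Set.Finite.of_finite_image
    (f := fun p : Letter × Letter => (letterIndex p.1, letterIndex p.2))
    (((Set.finite_Iic (letterIndex c)).prod (Set.finite_Iic (letterIndex c))).subset ?_) ?_
  · rintro _ ⟨p, hp, rfl⟩
    have h : letterIndex p.1 + letterIndex p.2 = letterIndex c := by
      rw [← letterIndex_letterAdd, hp]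
    exact ⟨show letterIndex p.1 ≤ _ by omega, show letterIndex p.2 ≤ _ by omega⟩
  · intro p _ p' _ h
    rw [Prod.mk.injEq] at h
    exact Prod.ext (letterIndex_injective h.1) (letterIndex_injective h.2)

/-- The coproduct of a letter, dual to the `q`-stuffle product. -/
noncomputable def letterCoproduct (q : k) (c : Letter) : PairPoly k :=
  pairWord k [c] [] + pairWord k [] [c] +
    q • ∑ p ∈ (finite_letterAdd_eq c).toFinset, pairWord k [p.1] [p.2]

/-- The coproduct dual to the `q`-stuffle product. -/
noncomputable def coproduct (q : k) : NCPoly k →ₐ[k] PairPoly k :=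
  MonoidAlgebra.lift k (PairPoly k) (FreeMonoid Letter) (FreeMonoid.lift (letterCoproduct q))

theorem coproduct_cons (q : k) (c : Letter) (w : Word) :
    coproduct q (word k (c :: w)) = letterCoproduct q c * coproduct q (word k w) := by
  simp [coproduct, word, FreeMonoid.ofList_cons]

theorem coproduct_word_nil (q : k) : coproduct q (word k []) = pairWord k [] [] :=
  map_one (coproduct q)

theorem stuffleWord_nil_left (q : k) (v : Word) : stuffleWord q [] v = word k v := by
  rw [stuffleWord]

theorem stuffleWord_nil_right (q : k) (u : Word) : stuffleWord q u [] = word k u := by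
  cases u <;> rw [stuffleWord]

theorem stuffleWord_cons_cons (q : k) (a b : Letter) (u v : Word) :
    stuffleWord q (a :: u) (b :: v) =
      word k [a] * stuffleWord q u (b :: v) + word k [b] * stuffleWord q (a :: u) v
        + q • (word k [letterAdd a b] * stuffleWord q u v) := by
  rw [stuffleWord]

theorem pairCoeff_coproduct_word (q : k) (u v w : Word) :
    pairCoeff u v (coproduct q (word k w)) = wordCoeff w (stuffleWord q u v) := by
  classical
  induction w generalizing u v with
  | nil =>
    rw [coproduct_word_nil, pairCoeff_pairWord]
    cases u with
    | nil =>
      rw [stuffleWord_nil_left, wordCoeff_word]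
      simp [eq_comm]
    | cons a u =>
      cases v with
      | nil => rw [stuffleWord_nil_right, wordCoeff_word]; simp
      | cons b v =>
        rw [stuffleWord_cons_cons]
        simp [wordCoeff_nil_letter_mul]
  | cons c w ih =>
    rw [coproduct_cons, letterCoproduct, add_mul, add_mul, map_add, map_add, smul_mul_assoc,
      map_smul, Finset.sum_mul, map_sum]
    simp only [pairWord_letters, mul_assoc]
    cases u with
    | nil =>
      simp only [pairCoeff_nil_letter_left_mul, Finset.sum_const_zero, smul_zero, add_zero,
        zero_add, stuffleWord_nil_left]
      cases v with
      | nil =>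
        rw [pairCoeff_nil_letter_right_mul, wordCoeff_word, if_neg (by simp)]
      | cons b v =>
        rw [pairCoeff_letter_right_mul, ih, stuffleWord_nil_left, word_cons,
          wordCoeff_cons_letter_mul]
        exact if_congr eq_comm rfl rfl
    | cons a u =>
      cases v with
      | nil =>
        have hz : ∀ (p : Letter × Letter) (Z : PairPoly k),
            pairCoeff (a :: u) [] (pairWord k [p.1] [] * (pairWord k [] [p.2] * Z)) = 0 := by
          intro p Z
          rw [pairCoeff_letter_left_mul, pairCoeff_nil_letter_right_mul, ite_self]
        simp only [hz, Finset.sum_const_zero, smul_zero, add_zero, pairCoeff_nil_letter_right_mul]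
        rw [pairCoeff_letter_left_mul, ih, stuffleWord_nil_right, stuffleWord_nil_right,
          word_cons, wordCoeff_cons_letter_mul]
        exact if_congr eq_comm rfl rfl
      | cons b v =>
        simp only [pairCoeff_letter_left_mul, pairCoeff_letter_right_mul, ih]
        rw [stuffleWord_cons_cons, map_add, map_add, map_smul, wordCoeff_cons_letter_mul,
          wordCoeff_cons_letter_mul, wordCoeff_cons_letter_mul]
        congr 1
        · congr 1 <;> exact if_congr eq_comm rfl rfl
        · congr 1
          rw [Finset.sum_congr rfl (g := fun p => if p = (a, b)
            then wordCoeff w (stuffleWord q u v) else 0)]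
          · rw [Finset.sum_ite_eq']
            exact if_congr (Set.Finite.mem_toFinset _) rfl rfl
          · rintro ⟨p1, p2⟩ _
            simp only [Prod.mk.injEq, ite_and]

/-- The pairing of `P ⊗ Q` with the elements of the tensor square. -/
noncomputable def tensorScal (P Q : NCPoly k) : PairPoly k →ₗ[k] k :=
  P.coeff.sum fun u a => Q.coeff.sum fun v b =>
    (a * b) • pairCoeff (FreeMonoid.toList u) (FreeMonoid.toList v)

/-- The coproduct is dual to the `q`-stuffle product. -/
theorem scal_stuffle (q : k) (P Q R : NCPoly k) :
    scal (stuffle q P Q) R = tensorScal P Q (coproduct q R) := by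
  have h : scalBilin (stuffle q P Q) = tensorScal P Q ∘ₗ (coproduct q).toLinearMap := by
    refine ncPoly_hom_ext fun w => ?_
    rw [← scal_eq_scalBilin, scal_word_right]
    simp only [stuffle, tensorScal, Finsupp.sum, map_sum, map_smul, LinearMap.comp_apply,
      LinearMap.sum_apply, LinearMap.smul_apply, AlgHom.toLinearMap_apply,
      pairCoeff_coproduct_word]
  rw [scal_eq_scalBilin, h]
  rfl

theorem tensorScal_tensorLeft_mul_tensorRight (P Q A B : NCPoly k) :
    tensorScal P Q (tensorLeft k A * tensorRight k B) = scal P A * scal Q B := by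
  simp only [tensorScal, scal, Finsupp.sum, LinearMap.sum_apply, LinearMap.smul_apply,
    pairCoeff_tensorLeft_mul_tensorRight, Finset.sum_mul_sum, wordCoeff_apply, smul_eq_mul,
    FreeMonoid.ofList_toList]
  exact Finset.sum_congr rfl fun _ _ => Finset.sum_congr rfl fun _ _ => by ring

end Coproduct

section Primitive

variable {k : Type*} [CommRing k]

theorem tensorScal_pairWord (P Q : NCPoly k) (u v : Word) :
    tensorScal P Q (pairWord k u v) = wordCoeff u P * wordCoeff v Q := by
  rw [show pairWord k u v = tensorLeft k (word k u) * tensorRight k (word k v) by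
    rw [tensorLeft_word, tensorRight_word, pairWord_mul, List.append_nil, List.nil_append],
    tensorScal_tensorLeft_mul_tensorRight, scal_word_right, scal_word_right]

theorem coproduct_letter (q : k) (c : Letter) :
    coproduct q (word k [c]) = letterCoproduct q c := by
  rw [coproduct_cons, word_nil, map_one, mul_one]

theorem wordCoeff_nil_stuffle (q : k) (P Q : NCPoly k) :
    wordCoeff [] (stuffle q P Q) = wordCoeff [] P * wordCoeff [] Q := by
  rw [← scal_word_right, scal_stuffle, coproduct_word_nil, tensorScal_pairWord]

theorem wordCoeff_letter_stuffle (q : k) (P Q : NCPoly k) (c : Letter) :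
    wordCoeff [c] (stuffle q P Q) = wordCoeff [c] P * wordCoeff [] Q +
      wordCoeff [] P * wordCoeff [c] Q +
      q * ∑ p ∈ (finite_letterAdd_eq c).toFinset, wordCoeff [p.1] P * wordCoeff [p.2] Q := by
  rw [← scal_word_right, scal_stuffle, coproduct_letter, letterCoproduct]
  simp only [map_add, map_smul, map_sum, tensorScal_pairWord, smul_eq_mul]

theorem stuffleList_cons (q : k) (P : NCPoly k) (L : List (NCPoly k)) :
    stuffleList q (P :: L) = stuffle q P (stuffleList q L) := rfl

theorem wordCoeff_nil_stuffleList (q : k) {U : List Word} (hU : U ≠ []) (h : ∀ u ∈ U, u ≠ []) :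
    wordCoeff [] (stuffleList q (U.map (word k))) = 0 := by
  classical
  cases U with
  | nil => exact absurd rfl hU
  | cons u U =>
    rw [List.map_cons, stuffleList_cons, wordCoeff_nil_stuffle, wordCoeff_word,
      if_neg (h u (by simp)), zero_mul]

theorem wordCoeff_letter_stuffleList_cons (q : k) (c : Letter) (u : Word) {U : List Word}
    (hU : U ≠ []) (h : ∀ v ∈ u :: U, v ≠ []) :
    wordCoeff [c] (stuffleList q ((u :: U).map (word k))) =
      q * ∑ p ∈ (finite_letterAdd_eq c).toFinset, wordCoeff [p.1] (word k u) *
        wordCoeff [p.2] (stuffleList q (U.map (word k))) := by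
  classical
  rw [List.map_cons, stuffleList_cons, wordCoeff_letter_stuffle,
    wordCoeff_nil_stuffleList q hU fun v hv => h v (by simp [hv]), wordCoeff_word [],
    if_neg (h u (by simp)), mul_zero, zero_mul, zero_add, zero_add]

theorem wordCoeff_letter_stuffleList_singleton (q : k) (c : Letter) (u : Word) :
    wordCoeff [c] (stuffleList q ([u].map (word k))) = wordCoeff [c] (word k u) := by
  classical
  have h1 (a : Letter) : wordCoeff [a] (1 : NCPoly k) = 0 := by
    rw [← word_nil, wordCoeff_word, if_neg (by simp)]
  have h2 : wordCoeff [] (1 : NCPoly k) = 1 := wordCoeff_word_self []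
  rw [List.map_singleton, stuffleList_cons, wordCoeff_letter_stuffle, stuffleList, List.foldr_nil]
  simp [h1, h2]

theorem exists_letters_of_wordCoeff_letter_stuffleList_ne_zero (q : k) {c : Letter}
    {U : List Word} (hU : U ≠ []) (h : ∀ u ∈ U, u ≠ [])
    (hc : wordCoeff [c] (stuffleList q (U.map (word k))) ≠ 0) :
    ∃ w : Word, U = w.map fun a => [a] := by
  classical
  induction U generalizing c with
  | nil => exact absurd rfl hU
  | cons u U ih =>
    rcases eq_or_ne U [] with rfl | hU'
    · rw [wordCoeff_letter_stuffleList_singleton, wordCoeff_word] at hc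
      have : u = [c] := by
        by_contra hne
        exact hc (if_neg hne)
      exact ⟨[c], by simp [this]⟩
    · rw [wordCoeff_letter_stuffleList_cons q c u hU' h] at hc
      obtain ⟨p, _, hp⟩ := Finset.exists_ne_zero_of_sum_ne_zero (right_ne_zero_of_mul hc)
      obtain ⟨w, rfl⟩ := ih hU' (fun v hv => h v (by simp [hv])) (right_ne_zero_of_mul hp)
      have : u = [p.1] := by
        by_contra hne
        exact left_ne_zero_of_mul hp (by rw [wordCoeff_word, if_neg hne])
      exact ⟨p.1 :: w, by simp [this]⟩

open Classical in
theorem wordCoeff_letter_stuffleList_letters (q : k) (c : Letter) {w : Word} (hw : w ≠ []) :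
    wordCoeff [c] (stuffleList q ((w.map fun a => [a]).map (word k))) =
      if weight w = letterIndex c then q ^ (w.length - 1) else 0 := by
  induction w generalizing c with
  | nil => exact absurd rfl hw
  | cons a w ih =>
    rcases eq_or_ne w [] with rfl | hw'
    · rw [List.map_singleton, wordCoeff_letter_stuffleList_singleton, wordCoeff_word]
      simp only [List.cons.injEq, and_true, weight_cons, weight_nil, add_zero,
        letterIndex_injective.eq_iff, List.length_singleton, tsub_self, pow_zero]
    · rw [List.map_cons, wordCoeff_letter_stuffleList_cons q c _ (by simpa using hw') (by simp)]
      simp only [ih _ hw']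
      have hpos : 0 < weight w := by
        rw [pos_iff_ne_zero]
        exact fun h => hw' (eq_nil_of_weight_eq_zero h)
      obtain ⟨b, hb⟩ : ∃ b, letterIndex b = weight w :=
        ⟨letterY ⟨weight w, hpos⟩, rfl⟩
      rw [Finset.sum_congr rfl (g := fun p => if p = (a, b) then q ^ (w.length - 1) else 0)]
      · rw [Finset.sum_ite_eq']
        have : letterAdd a b = c ↔ weight (a :: w) = letterIndex c := by
          rw [← letterIndex_injective.eq_iff, letterIndex_letterAdd, hb, weight_cons]
        have hm : (a, b) ∈ (finite_letterAdd_eq c).toFinset ↔ weight (a :: w) = letterIndex c :=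
          (Set.Finite.mem_toFinset _).trans this
        rw [if_congr hm rfl rfl, mul_ite, mul_zero,
          ← pow_succ', List.length_cons, Nat.sub_add_cancel (List.length_pos_iff.mpr hw'),
          Nat.add_sub_cancel]
      · rintro ⟨p1, p2⟩ _
        simp only [wordCoeff_word, ← hb, letterIndex_injective.eq_iff, List.cons.injEq, and_true,
          Prod.mk.injEq]
        by_cases h1 : a = p1
        · by_cases h2 : b = p2
          · rw [if_pos h1, if_pos h2, if_pos ⟨h1.symm, h2.symm⟩, one_mul]
          · rw [if_neg h2, if_neg (show ¬(p1 = a ∧ p2 = b) from fun h => h2 h.2.symm), mul_zero]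
        · rw [if_neg h1, if_neg (show ¬(p1 = a ∧ p2 = b) from fun h => h1 h.1.symm), zero_mul]

theorem finsum_wordSeqs_letter (q : k) (c : Letter) {n : ℕ} (hn : 1 ≤ n) :
    (∑ᶠ U ∈ wordSeqs n, scal (word k [c]) (stuffleList q (U.map (word k))) •
      (U.map (word k)).prod) =
    ∑ w ∈ (finite_weight_eq (letterIndex c)).toFinset with w.length = n,
      q ^ (n - 1) • word k w := by
  classical
  have hinj : Function.Injective fun w : Word => w.map fun a => [a] :=
    List.map_injective_iff.mpr fun a b h => by simpa using h
  have hlen (w : Word) : (w.map fun a => [a]).length = w.length := List.length_map _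
  rw [finsum_mem_eq_sum_of_inter_support_eq (t := ((finite_weight_eq (letterIndex c)).toFinset.filter
    fun w => w.length = n).image fun w : Word => w.map fun a => [a])]
  · rw [Finset.sum_image hinj.injOn]
    refine Finset.sum_congr rfl fun w hw => ?_
    rw [Finset.mem_filter, Set.Finite.mem_toFinset] at hw
    obtain ⟨hw1, hw2⟩ := hw
    replace hw1 : weight w = letterIndex c := hw1
    have hne : w ≠ [] := by
      rintro rfl
      simp at hw2
      omega
    rw [scal_word_left, wordCoeff_letter_stuffleList_letters q c hne, if_pos hw1, hw2,
      map_word_prod]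
    congr 2
    clear hw1 hw2 hne
    induction w with
    | nil => rfl
    | cons a w ih => rw [List.map_cons, List.flatten_cons, ih, List.singleton_append]
  · ext U
    simp only [Set.mem_inter_iff, and_congr_left_iff, Finset.mem_coe, Finset.mem_image,
      Finset.mem_filter, Set.Finite.mem_toFinset]
    intro hU
    rw [Function.mem_support, scal_word_left] at hU
    replace hU : wordCoeff [c] (stuffleList q (U.map (word k))) ≠ 0 := fun h => hU (by
      rw [h, zero_smul])
    constructor
    · rintro ⟨h1, h2⟩
      have hne : U ≠ [] := by
        rintro rfl
        simp at h1
        omega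
      obtain ⟨w, rfl⟩ := exists_letters_of_wordCoeff_letter_stuffleList_ne_zero q hne h2 hU
      refine ⟨w, ⟨?_, by rw [← h1, hlen]⟩, rfl⟩
      by_contra hw
      rw [wordCoeff_letter_stuffleList_letters q c (by simpa using hne)] at hU
      exact hU (if_neg hw)
    · rintro ⟨w, ⟨_, h2⟩, rfl⟩
      exact ⟨by rw [hlen, h2], by simp⟩

variable [Algebra ℚ k]

/-- The coefficient in `π₁` of a letter of the words of length `n` and of the same weight. -/
noncomputable def logCoeff (q : k) (n : ℕ) : k :=
  ((-1 : ℚ) ^ (n - 1) / (n : ℚ)) • q ^ (n - 1)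

open Classical in
theorem wordCoeff_pi1_letter (q : k) (c : Letter) (w : Word) :
    wordCoeff w (pi1 q (word k [c])) =
      if weight w = letterIndex c then logCoeff q w.length else 0 := by
  rw [pi1, linearExt_word, if_neg (by simp)]
  have hin : ∀ n ∈ {n : ℕ | 2 ≤ n}, ((-1 : ℚ) ^ (n - 1) / (n : ℚ)) •
      (∑ᶠ U ∈ wordSeqs n, scal (word k [c]) (stuffleList q (U.map (word k))) •
        (U.map (word k)).prod) = ((-1 : ℚ) ^ (n - 1) / (n : ℚ)) •
      ∑ w ∈ (finite_weight_eq (letterIndex c)).toFinset with w.length = n,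
        q ^ (n - 1) • word k w := fun n hn => by
    rw [finsum_wordSeqs_letter q c (Nat.le_of_succ_le hn)]
  rw [finsum_mem_congr rfl hin, finsum_mem_eq_sum_of_subset (t := Finset.Icc 2 (letterIndex c))]
  · have hcoeff (n : ℕ) : wordCoeff w (((-1 : ℚ) ^ (n - 1) / (n : ℚ)) •
        ∑ w ∈ (finite_weight_eq (letterIndex c)).toFinset with w.length = n,
          q ^ (n - 1) • word k w) =
        if w.length = n then (if weight w = letterIndex c then logCoeff q n else 0) else 0 := by
      rw [map_rat_smul, map_sum]
      simp only [map_smul, wordCoeff_word, smul_eq_mul, mul_ite, mul_one, mul_zero]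
      rw [Finset.sum_ite_eq', smul_ite, smul_zero]
      simp only [Finset.mem_filter, Set.Finite.mem_toFinset]
      rw [← ite_and]
      exact if_congr and_comm rfl rfl
    rw [map_add, map_sum, Finset.sum_congr rfl fun n _ => hcoeff n, Finset.sum_ite_eq,
      wordCoeff_word]
    have hw := length_le_weight w
    have hc := letterIndex_pos c
    by_cases h : weight w = letterIndex c
    · by_cases h1 : w.length = 1
      · obtain ⟨a, rfl⟩ := List.length_eq_one_iff.mp h1
        have hac : a = c := letterIndex_injective (by simpa [weight] using h)
        subst hac
        simp [weight, logCoeff]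
      · have h0 : w.length ≠ 0 := by
          intro h0
          rw [List.length_eq_zero_iff.mp h0, weight_nil] at h
          omega
        have hne : [c] ≠ w := by
          rintro rfl
          exact h1 rfl
        rw [if_neg hne, if_pos (Finset.mem_Icc.mpr ⟨by omega, by omega⟩), zero_add]
    · have hne : [c] ≠ w := by
        rintro rfl
        exact h rfl
      rw [if_neg hne, if_neg h, ite_self, add_zero]
  · rintro n ⟨hn1, hn2⟩
    rw [Finset.coe_Icc, Set.mem_Icc]
    refine ⟨hn1, ?_⟩
    by_contra hlt
    refine hn2 ?_
    simp only
    rw [Finset.filter_false_of_mem, Finset.sum_empty, smul_zero]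
    intro v hv hvn
    have h1 : weight v = letterIndex c :=
      (Set.Finite.mem_toFinset (finite_weight_eq (letterIndex c))).mp hv
    have h2 := length_le_weight v
    omega
  · intro n hn
    exact (Finset.mem_Icc.mp hn).1

theorem piCheck1_letter (q : k) (c : Letter) : piCheck1 q (word k [c]) = word k [c] := by
  classical
  rw [piCheck1, linearExt_word, if_neg (by simp), finsum_mem_eq_zero_of_forall_eq_zero, add_zero]
  intro n hn
  rw [finsum_mem_eq_zero_of_forall_eq_zero, smul_zero]
  rintro U ⟨hU1, hU2⟩
  rw [scal_word_left, map_word_prod, wordCoeff_word, if_neg, zero_smul]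
  intro h
  have hlen : U.length ≤ U.flatten.length := by
    rw [List.length_flatten]
    refine (List.length_map (as := U) List.length) ▸ List.length_le_sum_of_one_le _ ?_
    intro i hi
    obtain ⟨u, hu, rfl⟩ := List.mem_map.mp hi
    exact List.length_pos_iff.mpr (hU2 u hu)
  rw [h, hU1] at hlen
  have : 2 ≤ n := hn
  simp at hlen
  omega

end Primitive

section StuffleLength

open Polynomial

variable {k : Type*} [CommRing k]

/-- The length generating polynomial of the `q`-stuffle product of words of lengths `a`, `b`. -/
noncomputable def stuffleLength (q : k) : ℕ → ℕ → k[X]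
  | 0, b => X ^ b
  | a + 1, 0 => X ^ (a + 1)
  | a + 1, b + 1 =>
      X * (stuffleLength q a (b + 1) + stuffleLength q (a + 1) b + C q * stuffleLength q a b)

theorem stuffleLength_zero_left (q : k) (b : ℕ) : stuffleLength q 0 b = X ^ b := by
  rw [stuffleLength]

theorem stuffleLength_zero_right (q : k) (a : ℕ) : stuffleLength q a 0 = X ^ a := by
  cases a <;> rw [stuffleLength]

theorem stuffleLength_succ_succ (q : k) (a b : ℕ) : stuffleLength q (a + 1) (b + 1) =
    X * (stuffleLength q a (b + 1) + stuffleLength q (a + 1) b + C q * stuffleLength q a b) := by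
  rw [stuffleLength]

/-- The algebra homomorphism that sends every letter to `X`. -/
noncomputable def lengthHom (k : Type*) [CommRing k] : NCPoly k →ₐ[k] k[X] :=
  MonoidAlgebra.lift k k[X] (FreeMonoid Letter) (FreeMonoid.lift fun _ => X)

theorem lengthHom_word (w : Word) : lengthHom k (word k w) = X ^ w.length := by
  simp only [lengthHom, word, MonoidAlgebra.lift_single, one_smul]
  induction w with
  | nil => rfl
  | cons a w ih =>
    rw [FreeMonoid.ofList_cons, map_mul, ih, FreeMonoid.lift_eval_of, List.length_cons, pow_succ']

theorem lengthHom_stuffleWord (q : k) : ∀ u v : Word,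
    lengthHom k (stuffleWord q u v) = stuffleLength q u.length v.length
  | [], v => by rw [stuffleWord_nil_left, lengthHom_word, List.length_nil, stuffleLength_zero_left]
  | a :: u, [] => by
    rw [stuffleWord_nil_right, lengthHom_word, List.length_nil, stuffleLength_zero_right]
  | a :: u, b :: v => by
    rw [stuffleWord_cons_cons, map_add, map_add, map_smul, map_mul, map_mul, map_mul,
      lengthHom_stuffleWord q u (b :: v), lengthHom_stuffleWord q (a :: u) v,
      lengthHom_stuffleWord q u v, lengthHom_word, lengthHom_word, lengthHom_word,
      smul_eq_C_mul]
    simp only [List.length_cons, List.length_nil, zero_add, pow_one, stuffleLength_succ_succ]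
    ring
termination_by u v => u.length + v.length

theorem stuffleLength_one_left (q : k) (b : ℕ) :
    stuffleLength q 1 b = (b + 1 : k[X]) * X ^ (b + 1) + (b : k[X]) * C q * X ^ b := by
  induction b with
  | zero => simp [stuffleLength_zero_right]
  | succ b ih =>
    rw [← zero_add 1, stuffleLength_succ_succ, zero_add, ih, stuffleLength_zero_left,
      stuffleLength_zero_left]
    push_cast
    ring

/-- Multiplication by the variable `T` in the basis of the polynomials
`T (T - q) ⋯ (T - (n - 1) q) / n!`. -/
noncomputable def risingOp (q : k) (f : k[X]) : k[X] :=
  X * f + X * (X + C q) * derivative f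

theorem risingOp_X_pow (q : k) (n : ℕ) :
    risingOp q (X ^ n) = (n + 1 : k[X]) * X ^ (n + 1) + (n : k[X]) * C q * X ^ n := by
  cases n with
  | zero => simp [risingOp]
  | succ n =>
    rw [risingOp, derivative_X_pow]
    simp only [map_natCast, Nat.add_sub_cancel]
    push_cast
    ring

theorem risingOp_X_mul (q : k) (f : k[X]) :
    risingOp q (X * f) = X * risingOp q f + X * (X + C q) * f := by
  rw [risingOp, risingOp, derivative_mul, derivative_X]
  ring

theorem risingOp_add (q : k) (f g : k[X]) :
    risingOp q (f + g) = risingOp q f + risingOp q g := by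
  rw [risingOp, risingOp, risingOp, derivative_add]
  ring

theorem risingOp_C_mul (q r : k) (f : k[X]) :
    risingOp q (C r * f) = C r * risingOp q f := by
  rw [risingOp, risingOp, derivative_C_mul]
  ring

theorem risingOp_stuffleLength (q : k) : ∀ a b : ℕ, risingOp q (stuffleLength q a b) =
    (a + 1 : k[X]) * stuffleLength q (a + 1) b + (a : k[X]) * C q * stuffleLength q a b
  | 0, b => by
    rw [zero_add, stuffleLength_one_left, stuffleLength_zero_left, risingOp_X_pow]
    push_cast
    ring
  | a + 1, 0 => by
    rw [stuffleLength_zero_right, stuffleLength_zero_right, risingOp_X_pow]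
  | a + 1, b + 1 => by
    have h1 := risingOp_stuffleLength q a (b + 1)
    have h2 := risingOp_stuffleLength q (a + 1) b
    have h3 := risingOp_stuffleLength q a b
    rw [stuffleLength_succ_succ q (a + 1) b, stuffleLength_succ_succ q a b, risingOp_X_mul,
      risingOp_add, risingOp_add, risingOp_C_mul, h1, h2, h3, stuffleLength_succ_succ q a b]
    push_cast
    ring

theorem coeff_zero_stuffleLength_succ (q : k) (a b : ℕ) :
    (stuffleLength q a (b + 1)).coeff 0 = 0 := by
  cases a with
  | zero => rw [stuffleLength_zero_left, coeff_X_pow, if_neg (by omega)]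
  | succ a => rw [stuffleLength_succ_succ, mul_coeff_zero, coeff_X_zero, zero_mul]

variable [Algebra ℚ k]

/-- The linear form `X ^ n ↦ logCoeff q n`. -/
noncomputable def logForm (q : k) : k[X] →ₗ[k] k :=
  Polynomial.lsum fun n => LinearMap.lsmul k k (logCoeff q n)

theorem logForm_X_pow (q : k) (n : ℕ) : logForm q (X ^ n) = logCoeff q n := by
  simp [logForm, Polynomial.lsum_apply, ← monomial_one_right_eq_X_pow]

theorem succ_mul_logCoeff_succ (q : k) (n : ℕ) :
    (n + 1 : k) * logCoeff q (n + 1) = (-q) ^ n := by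
  have h : ((n : ℚ) + 1) ≠ 0 := by positivity
  have h2 : (n + 1 : k) = algebraMap ℚ k (n + 1) := by simp
  rw [logCoeff, h2, ← Algebra.smul_def, smul_smul, Nat.add_sub_cancel, Nat.cast_add, Nat.cast_one,
    mul_div_cancel₀ _ h, Algebra.smul_def, neg_pow q]
  simp

theorem logForm_risingOp (q : k) (f : k[X]) : logForm q (risingOp q f) = f.coeff 0 := by
  induction f using Polynomial.induction_on' with
  | add f g hf hg => rw [risingOp_add, map_add, hf, hg, coeff_add]
  | monomial n r =>
    have hn (m : ℕ) (s : k) (j : ℕ) :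
        logForm q ((m : k[X]) * C s * X ^ j) = m * s * logCoeff q j := by
      rw [show (m : k[X]) * C s * X ^ j = (m * s) • X ^ j by
          simp [smul_eq_C_mul], map_smul, logForm_X_pow, smul_eq_mul]
    rw [← C_mul_X_pow_eq_monomial, risingOp_C_mul, risingOp_X_pow, ← smul_eq_C_mul, map_smul,
      map_add, hn, coeff_C_mul, coeff_X_pow, smul_eq_mul]
    have h1 := hn (n + 1) 1 (n + 1)
    rw [map_one, mul_one, mul_one] at h1
    push_cast at h1
    rw [h1, succ_mul_logCoeff_succ]
    cases n with
    | zero => simp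
    | succ n =>
      have := succ_mul_logCoeff_succ q n
      rw [if_neg (by omega), Nat.cast_succ, mul_right_comm, this]
      ring

theorem logForm_stuffleLength (q : k) (a b : ℕ) :
    logForm q (stuffleLength q (a + 1) (b + 1)) = 0 := by
  have key (a : ℕ) : (a + 1 : k) * logForm q (stuffleLength q (a + 1) (b + 1)) +
      a * q * logForm q (stuffleLength q a (b + 1)) = 0 := by
    have h := congrArg (logForm q) (risingOp_stuffleLength q a (b + 1))
    rw [logForm_risingOp, coeff_zero_stuffleLength_succ,
      show (a + 1 : k[X]) = C (a + 1 : k) by simp, show (a : k[X]) = C (a : k) by simp, ← C_mul,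
      ← smul_eq_C_mul, ← smul_eq_C_mul, map_add, map_smul, map_smul, smul_eq_mul,
      smul_eq_mul] at h
    exact h.symm
  have hu (a : ℕ) : IsUnit (a + 1 : k) := by
    rw [show (a + 1 : k) = algebraMap ℚ k (a + 1) by simp]
    exact (IsUnit.mk0 _ (by positivity)).map _
  induction a with
  | zero =>
    have := key 0
    simpa using this
  | succ a ih =>
    have := key (a + 1)
    rw [ih, mul_zero, add_zero] at this
    exact (hu (a + 1)).mul_right_eq_zero.mp this

end StuffleLength

section PrimitiveLetters

variable {k : Type*} [CommRing k]

theorem letter_mul_mem_wordSpan (c : Letter) {n m : ℕ} (h : letterIndex c + n = m) {P : NCPoly k}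
    (hP : P ∈ wordSpan k {w | weight w = n}) :
    word k [c] * P ∈ wordSpan k {w | weight w = m} := by
  refine mul_mem_wordSpan (word_mem_wordSpan (Set.mem_singleton [c])) hP ?_
  rintro _ rfl v hv
  have hv' : weight v = n := hv
  change weight (c :: v) = m
  rw [weight_cons, hv', h]

theorem stuffleWord_mem_wordSpan (q : k) : ∀ u v : Word,
    stuffleWord q u v ∈ wordSpan k {w | weight w = weight u + weight v}
  | [], v => by
    rw [stuffleWord_nil_left]
    refine word_mem_wordSpan ?_
    rw [weight_nil, zero_add]
    rfl
  | a :: u, [] => by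
    rw [stuffleWord_nil_right]
    exact word_mem_wordSpan rfl
  | a :: u, b :: v => by
    rw [stuffleWord_cons_cons]
    refine Submodule.add_mem _ (Submodule.add_mem _ ?_ ?_) (Submodule.smul_mem _ _ ?_)
    · refine letter_mul_mem_wordSpan a ?_ (stuffleWord_mem_wordSpan q u (b :: v))
      rw [weight_cons a]
      ring
    · refine letter_mul_mem_wordSpan b ?_ (stuffleWord_mem_wordSpan q (a :: u) v)
      rw [weight_cons b]
      ring
    · refine letter_mul_mem_wordSpan _ ?_ (stuffleWord_mem_wordSpan q u v)
      rw [weight_cons, weight_cons, letterIndex_letterAdd]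
      ring
termination_by u v => u.length + v.length

/-- An element `P` is primitive if its coproduct is `P ⊗ 1 + 1 ⊗ P`. -/
def IsPrimitive (q : k) (P : NCPoly k) : Prop :=
  coproduct q P = tensorLeft k P + tensorRight k P

theorem scal_stuffleWord (q : k) (u v : Word) (P : NCPoly k) :
    scal (stuffleWord q u v) P = pairCoeff u v (coproduct q P) := by
  rw [scal_eq_scalBilin]
  induction P using ncPoly_induction with
  | hw w => rw [← scal_eq_scalBilin, scal_word_right, pairCoeff_coproduct_word]
  | hadd P Q hP hQ => simp only [map_add, hP, hQ]
  | hsmul r P hP => simp only [map_smul, hP]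

open Classical in
theorem pairCoeff_tensorLeft (u v : Word) (P : NCPoly k) :
    pairCoeff u v (tensorLeft k P) = if v = [] then wordCoeff u P else 0 := by
  have h := pairCoeff_tensorLeft_mul_tensorRight u v P 1
  rw [map_one, mul_one, ← word_nil, wordCoeff_word] at h
  rw [h, mul_ite, mul_one, mul_zero]
  exact if_congr eq_comm rfl rfl

open Classical in
theorem pairCoeff_tensorRight (u v : Word) (P : NCPoly k) :
    pairCoeff u v (tensorRight k P) = if u = [] then wordCoeff v P else 0 := by
  have h := pairCoeff_tensorLeft_mul_tensorRight u v 1 P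
  rw [map_one, one_mul, ← word_nil, wordCoeff_word] at h
  rw [h, ite_mul, one_mul, zero_mul]
  exact if_congr eq_comm rfl rfl

theorem IsPrimitive.commutator {q : k} {P Q : NCPoly k} (hP : IsPrimitive q P)
    (hQ : IsPrimitive q Q) : IsPrimitive q (P * Q - Q * P) := by
  rw [IsPrimitive] at *
  have h1 := tensorLeft_mul_tensorRight_comm P Q
  have h2 := tensorLeft_mul_tensorRight_comm Q P
  simp only [map_sub, map_mul, hP, hQ, mul_add, add_mul, h1, h2]
  abel

variable [Algebra ℚ k]

open Classical in
theorem scal_pi1_letter (q : k) (c : Letter) {n : ℕ} {P : NCPoly k}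
    (hP : P ∈ wordSpan k {w | weight w = n}) :
    scal P (pi1 q (word k [c])) =
      if n = letterIndex c then logForm q (lengthHom k P) else 0 := by
  rw [scal_eq_scalBilin]
  refine Submodule.span_induction ?_ (by simp) ?_ ?_ hP
  · rintro _ ⟨w, hw, rfl⟩
    have hw' : weight w = n := hw
    rw [← scal_eq_scalBilin, scal_word_left, wordCoeff_pi1_letter, lengthHom_word, logForm_X_pow,
      hw']
  · intro P Q _ _ hP hQ
    rw [map_add, LinearMap.add_apply, hP, hQ, map_add, map_add]
    split_ifs <;> simp
  · intro r P _ hP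
    rw [map_smul, LinearMap.smul_apply, hP, map_smul, map_smul]
    split_ifs <;> simp

theorem scal_stuffleWord_pi1_letter (q : k) (c : Letter) {u v : Word} (hu : u ≠ [])
    (hv : v ≠ []) : scal (stuffleWord q u v) (pi1 q (word k [c])) = 0 := by
  classical
  rw [scal_pi1_letter q c (stuffleWord_mem_wordSpan q u v), lengthHom_stuffleWord]
  obtain ⟨a, u, rfl⟩ := List.exists_cons_of_ne_nil hu
  obtain ⟨b, v, rfl⟩ := List.exists_cons_of_ne_nil hv
  rw [List.length_cons, List.length_cons, logForm_stuffleLength, ite_self]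

theorem isPrimitive_pi1_letter (q : k) (c : Letter) : IsPrimitive q (pi1 q (word k [c])) := by
  classical
  have h0 : wordCoeff [] (pi1 q (word k [c])) = 0 := by
    rw [wordCoeff_pi1_letter, if_neg]
    exact (letterIndex_pos c).ne
  refine pairPoly_ext fun u v => ?_
  rw [map_add, pairCoeff_tensorLeft, pairCoeff_tensorRight, ← scal_stuffleWord]
  by_cases hu : u = []
  · subst hu
    rw [stuffleWord_nil_left, scal_word_left, h0, if_pos rfl, ite_self, zero_add]
  · by_cases hv : v = []
    · subst hv
      rw [stuffleWord_nil_right, scal_word_left, if_pos rfl, if_neg hu, add_zero]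
    · rw [scal_stuffleWord_pi1_letter q c hu hv, if_neg hu, if_neg hv, add_zero]

end PrimitiveLetters

section LyndonFactorization

theorem le_of_isPrefix {u v : Word} (h : u <+: v) : u ≤ v :=
  not_lt.mp (List.IsPrefix.le (α := Letter) h)

theorem exists_suffix_le_of_isPrefix_flatten {c : Word} {L : List Word} (hL : ∀ u ∈ L, u ≤ c)
    {t : Word} (ht : t ≠ []) (hp : t <+: L.flatten) : ∃ x, x ≠ [] ∧ x <:+ t ∧ x ≤ c := by
  induction L generalizing t with
  | nil => exact absurd (List.prefix_nil.mp hp) ht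
  | cons h L ih =>
    by_cases hth : t <+: h
    · exact ⟨t, ht, List.suffix_rfl, (le_of_isPrefix hth).trans (hL h (by simp))⟩
    · obtain ⟨z, hz⟩ := hp
      rw [List.flatten_cons] at hz
      rcases List.append_eq_append_iff.mp hz with ⟨t', h1, -⟩ | ⟨t', rfl, h2⟩
      · exact absurd ⟨t', h1.symm⟩ hth
      · have ht' : t' ≠ [] := by
          rintro rfl
          exact hth (by simp)
        obtain ⟨x, hx1, hx2, hx3⟩ := ih (fun u hu => hL u (by simp [hu])) ht' ⟨z, h2.symm⟩
        exact ⟨x, hx1, hx2.trans (List.suffix_append _ _), hx3⟩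

theorem eq_nil_of_isPrefix_flatten {a b t : Word} {L : List Word} (ha : a ≠ [])
    (hb : IsLyndon b) (hL : ∀ u ∈ L, u ≤ a) (h : b = a ++ t) (hp : t <+: L.flatten) :
    t = [] := by
  by_contra ht
  obtain ⟨x, hx1, ⟨z, hz⟩, hx3⟩ := exists_suffix_le_of_isPrefix_flatten hL ht hp
  have h1 : b < x := hb.2 (a ++ z) x (by simp [ha]) hx1 (by rw [h, ← hz, List.append_assoc])
  have h2 : a ≤ b := le_of_isPrefix ⟨t, h.symm⟩
  exact absurd (h1.trans_le (hx3.trans h2)) (lt_irrefl b)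

/-- Uniqueness of the factorization into a non-increasing product of Lyndon words. -/
theorem eq_of_flatten_eq {L L' : List Word} (hL : ∀ u ∈ L, IsLyndon u)
    (hL' : ∀ u ∈ L', IsLyndon u) (hc : L.Pairwise (· ≥ ·)) (hc' : L'.Pairwise (· ≥ ·))
    (h : L.flatten = L'.flatten) : L = L' := by
  induction L generalizing L' with
  | nil =>
    cases L' with
    | nil => rfl
    | cons b L' => exact absurd (by simpa using h) (by simp [(hL' b (by simp)).1])
  | cons a L ih =>
    cases L' with
    | nil => exact absurd (by simpa using h) (by simp [(hL a (by simp)).1])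
    | cons b L' =>
      rw [List.pairwise_cons] at hc hc'
      have ha := hL a (by simp)
      have hb := hL' b (by simp)
      rw [List.flatten_cons, List.flatten_cons] at h
      obtain rfl : a = b := by
        rcases List.append_eq_append_iff.mp h with ⟨t, h1, h2⟩ | ⟨t, h1, h2⟩
        · rw [h1, eq_nil_of_isPrefix_flatten ha.1 hb hc.1 h1 ⟨_, h2.symm⟩, List.append_nil]
        · rw [h1, eq_nil_of_isPrefix_flatten hb.1 ha hc'.1 h1 ⟨_, h2.symm⟩, List.append_nil]
      rw [ih (fun u hu => hL u (by simp [hu])) (fun u hu => hL' u (by simp [hu])) hc.2 hc'.2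
        (List.append_cancel_left h)]

theorem lyndonFactors_pairwise (w : Word) : (lyndonFactors w).Pairwise (· ≥ ·) :=
  List.isChain_iff_pairwise.mp (lyndonFactors_spec w).2.1

theorem lyndonFactors_flatten {L : List Word} (hL : ∀ u ∈ L, IsLyndon u)
    (hc : L.Pairwise (· ≥ ·)) : lyndonFactors L.flatten = L :=
  eq_of_flatten_eq (lyndonFactors_spec _).1 hL (lyndonFactors_pairwise _) hc
    (lyndonFactors_spec _).2.2

theorem isLyndon_drop_standardIndex (w : Word) (h : 2 ≤ w.length) :
    IsLyndon (w.drop (standardIndex w h)) := by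
  classical exact (Nat.find_spec (exists_lyndon_suffix w h)).2

theorem not_isLyndon_drop_of_lt_standardIndex {w : Word} {h : 2 ≤ w.length} {j : ℕ}
    (hj : 1 ≤ j) (hlt : j < standardIndex w h) : ¬IsLyndon (w.drop j) := fun hl => by
  classical exact Nat.find_min (exists_lyndon_suffix w h) hlt ⟨hj, hl⟩

theorem isLyndon_take_standardIndex {w : Word} (hw : IsLyndon w) (h : 2 ≤ w.length) :
    IsLyndon (w.take (standardIndex w h)) := by
  have hi1 := standardIndex_pos w h
  have hi2 := standardIndex_lt w h
  have hr := isLyndon_drop_standardIndex w h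
  have hmin := fun j => not_isLyndon_drop_of_lt_standardIndex (w := w) (h := h) (j := j)
  generalize standardIndex w h = i at *
  obtain ⟨h1, -, h3⟩ := lyndonFactors_spec (w.take i)
  have h2 := lyndonFactors_pairwise (w.take i)
  generalize lyndonFactors (w.take i) = L at *
  have hlen : L.flatten.length = i := by
    rw [h3, List.length_take]
    omega
  rcases List.eq_nil_or_concat L with rfl | ⟨L, u, rfl⟩
  · simp at hlen
    omega
  · have hu := h1 u (by simp)
    rcases eq_or_ne L [] with rfl | hne
    · simp at h3
      rwa [← h3]
    · exfalso
      have hsplit : w = L.flatten ++ (u ++ w.drop i) := by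
        conv_lhs => rw [← List.take_append_drop i w, ← h3]
        simp
      obtain ⟨x, hx⟩ := List.exists_mem_of_ne_nil L hne
      have hx1 := List.length_pos_iff.mpr (h1 x (by simp [hx])).1
      have hx2 : 0 < L.flatten.length := by
        refine List.length_pos_iff.mpr fun h0 => ?_
        exact (h1 x (by simp [hx])).1 (List.flatten_eq_nil_iff.mp h0 x hx)
      rcases lt_or_ge u (w.drop i) with hlt | hge
      · refine hmin L.flatten.length hx2 ?_ ?_
        · have := List.length_pos_iff.mpr hu.1
          simp at hlen ⊢
          omega
        · have : w.drop L.flatten.length = u ++ w.drop i := by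
            conv_lhs => rw [hsplit]
            simp
          rw [this]
          exact hu.append hr hlt
      · have := eq_of_flatten_eq (L := L ++ [u] ++ [w.drop i]) (L' := [w]) ?_ (by simpa using hw)
          ?_ (by simp) (by simpa using hsplit.symm)
        · have := congrArg List.length this
          simp at this
        · intro v hv
          rw [List.mem_append, List.mem_singleton] at hv
          rcases hv with hv | rfl
          · exact h1 v (by simpa using hv)
          · exact hr
        · rw [List.pairwise_append]
          simp only [List.concat_eq_append] at h2
          refine ⟨h2, by simp, fun a ha b hb => ?_⟩
          rw [List.mem_singleton] at hb
          subst hb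
          rw [List.pairwise_append] at h2
          rw [List.mem_append, List.mem_singleton] at ha
          rcases ha with ha | rfl
          · exact hge.trans (h2.2.2 a ha u (by simp))
          · exact hge

end LyndonFactorization

section Triangularity

/-- The words of the same weight as `w` that are longer than `w`, or of the same length and
larger than `w`. -/
def higherWords (w : Word) : Set Word :=
  {v | weight v = weight w ∧ (w.length < v.length ∨ w.length = v.length ∧ w < v)}

theorem append_mem_higherWords_left {u u' : Word} (h : u' ∈ higherWords u) (v : Word) :
    u' ++ v ∈ higherWords (u ++ v) := by
  obtain ⟨h1, h2⟩ := h
  refine ⟨by rw [weight_append, weight_append, h1], ?_⟩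
  rw [List.length_append, List.length_append]
  rcases h2 with h2 | ⟨h2, h3⟩
  · exact Or.inl (by omega)
  · exact Or.inr ⟨by omega, append_lt_append_of_lt_of_length_le h3 h2.ge v v⟩

theorem append_mem_higherWords_right {v v' : Word} (h : v' ∈ higherWords v) (u : Word) :
    u ++ v' ∈ higherWords (u ++ v) := by
  obtain ⟨h1, h2⟩ := h
  refine ⟨by rw [weight_append, weight_append, h1], ?_⟩
  rw [List.length_append, List.length_append]
  rcases h2 with h2 | ⟨h2, h3⟩
  · exact Or.inl (by omega)
  · exact Or.inr ⟨by omega, List.append_left_lt h3⟩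

theorem higherWords_trans {u v w : Word} (h : v ∈ higherWords u) (h' : w ∈ higherWords v) :
    w ∈ higherWords u := by
  obtain ⟨h1, h2⟩ := h
  obtain ⟨h3, h4⟩ := h'
  refine ⟨h3.trans h1, ?_⟩
  rcases h2 with h2 | ⟨h2, h5⟩
  · exact Or.inl (by omega)
  · rcases h4 with h4 | ⟨h4, h6⟩
    · exact Or.inl (by omega)
    · exact Or.inr ⟨by omega, h5.trans h6⟩

variable {k : Type*} [CommRing k]

/-- The polynomial `P` has leading term `w`. -/
def HasLeadingWord (P : NCPoly k) (w : Word) : Prop :=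
  P - word k w ∈ wordSpan k (higherWords w)

theorem HasLeadingWord.mul {P Q : NCPoly k} {u v : Word} (hP : HasLeadingWord P u)
    (hQ : HasLeadingWord Q v) : HasLeadingWord (P * Q) (u ++ v) := by
  have h : P * Q - word k (u ++ v) = (P - word k u) * (Q - word k v) +
      (P - word k u) * word k v + word k u * (Q - word k v) := by
    rw [word_append]
    noncomm_ring
  rw [HasLeadingWord, h]
  refine Submodule.add_mem _ (Submodule.add_mem _ ?_ ?_) ?_
  · exact mul_mem_wordSpan hP hQ fun u' hu' v' hv' =>
      higherWords_trans (append_mem_higherWords_right hv' u) (append_mem_higherWords_left hu' v')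
  · refine mul_mem_wordSpan hP (word_mem_wordSpan (Set.mem_singleton v)) ?_
    rintro u' hu' _ rfl
    exact append_mem_higherWords_left hu' _
  · refine mul_mem_wordSpan (word_mem_wordSpan (Set.mem_singleton u)) hQ ?_
    rintro _ rfl v' hv'
    exact append_mem_higherWords_right hv' _

theorem HasLeadingWord.sub {P Q : NCPoly k} {u v : Word} (hP : HasLeadingWord P u)
    (hQ : HasLeadingWord Q v) (h : v ∈ higherWords u) : HasLeadingWord (P - Q) u := by
  rw [HasLeadingWord, show P - Q - word k u = (P - word k u) - ((Q - word k v) + word k v) by abel]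
  refine Submodule.sub_mem _ hP (Submodule.add_mem _ ?_ (word_mem_wordSpan h))
  exact wordSpan_mono (fun w hw => higherWords_trans h hw) hQ

variable [Algebra ℚ k]

theorem hasLeadingWord_pi1_letter (q : k) (c : Letter) :
    HasLeadingWord (pi1 q (word k [c])) [c] := by
  classical
  rw [HasLeadingWord, mem_wordSpan_iff]
  intro w hw
  rw [map_sub, wordCoeff_pi1_letter, wordCoeff_word]
  split_ifs with h1 h2 h2
  · rw [← h2]
    simp [logCoeff]
  · exfalso
    have hwt : weight w = weight [c] := h1
    refine hw ⟨hwt, Or.inl ?_⟩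
    by_contra hlen
    have hpos := letterIndex_pos c
    match w, hlen with
    | [], _ =>
      rw [weight_nil] at h1
      omega
    | [a], _ => exact h2 (by rw [weight_singleton_injective hwt])
    | a :: b :: w, hlen => simp at hlen
  · exact absurd (by rw [← h2]; rfl) h1
  · simp

theorem piLyndon_of_length_lt (q : k) {l : Word} (h : ¬2 ≤ l.length) :
    PiLyndon q l = pi1 q (word k l) := by
  rw [PiLyndon, dif_neg h]

theorem piLyndon_of_le_length (q : k) {l : Word} (h : 2 ≤ l.length) :
    PiLyndon q l =
      PiLyndon q (l.take (standardIndex l h)) * PiLyndon q (l.drop (standardIndex l h))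
        - PiLyndon q (l.drop (standardIndex l h)) * PiLyndon q (l.take (standardIndex l h)) := by
  rw [PiLyndon, dif_pos h]

/-- Induction on Lyndon words along the standard factorization. -/
theorem lyndon_induction {p : Word → Prop} (hletter : ∀ c, p [c])
    (hstep : ∀ (l : Word) (h : 2 ≤ l.length), IsLyndon l → p (l.take (standardIndex l h)) →
      p (l.drop (standardIndex l h)) → p l) (l : Word) (hl : IsLyndon l) : p l := by
  by_cases h : 2 ≤ l.length
  · have h1 := standardIndex_pos l h
    have h2 := standardIndex_lt l h
    exact hstep l h hl (lyndon_induction hletter hstep _ (isLyndon_take_standardIndex hl h))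
      (lyndon_induction hletter hstep _ (isLyndon_drop_standardIndex l h))
  · have h0 := List.length_pos_iff.mpr hl.1
    obtain ⟨c, rfl⟩ := List.length_eq_one_iff.mp (show l.length = 1 by omega)
    exact hletter c
termination_by l.length
decreasing_by
  all_goals
    simp only [List.length_take, List.length_drop]
    omega

theorem hasLeadingWord_piLyndon (q : k) (l : Word) (hl : IsLyndon l) :
    HasLeadingWord (PiLyndon q l) l := by
  refine lyndon_induction (p := fun l => HasLeadingWord (PiLyndon q l) l) (fun c => ?_)
    (fun l h hl h1 h2 => ?_) l hl
  · rw [piLyndon_of_length_lt q (by simp)]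
    exact hasLeadingWord_pi1_letter q c
  · rw [piLyndon_of_le_length q h]
    have h3 := h1.mul h2
    have h4 := h2.mul h1
    rw [List.take_append_drop] at h3
    refine h3.sub h4 ⟨?_, Or.inr ⟨?_, ?_⟩⟩
    · rw [weight_append, add_comm, ← weight_append, List.take_append_drop]
    · rw [List.length_append, add_comm, ← List.length_append, List.take_append_drop]
    · have hi1 := standardIndex_pos l h
      have hi2 := standardIndex_lt l h
      refine (hl.2 (l.take (standardIndex l h)) _ ?_ ?_
        (List.take_append_drop _ l).symm).trans_le (le_of_isPrefix (List.prefix_append _ _))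
      · refine List.length_pos_iff.mp ?_
        rw [List.length_take]
        omega
      · refine List.length_pos_iff.mp ?_
        rw [List.length_drop]
        omega

theorem isPrimitive_piLyndon (q : k) (l : Word) (hl : IsLyndon l) :
    IsPrimitive q (PiLyndon q l) := by
  refine lyndon_induction (p := fun l => IsPrimitive q (PiLyndon q l)) (fun c => ?_)
    (fun l h _ h1 h2 => ?_) l hl
  · rw [piLyndon_of_length_lt q (by simp)]
    exact isPrimitive_pi1_letter q c
  · rw [piLyndon_of_le_length q h]
    exact h1.commutator h2

theorem hasLeadingWord_prod (q : k) {L : List Word} (hL : ∀ u ∈ L, IsLyndon u) :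
    HasLeadingWord (L.map (PiLyndon q)).prod L.flatten := by
  induction L with
  | nil =>
    rw [HasLeadingWord, List.map_nil, List.prod_nil, List.flatten_nil, word_nil, sub_self]
    exact Submodule.zero_mem _
  | cons l L ih =>
    rw [List.map_cons, List.prod_cons, List.flatten_cons]
    exact (hasLeadingWord_piLyndon q l (hL l (by simp))).mul (ih fun u hu => hL u (by simp [hu]))

theorem hasLeadingWord_piWord (q : k) (w : Word) : HasLeadingWord (PiWord q w) w := by
  have := hasLeadingWord_prod q (lyndonFactors_spec w).1
  rwa [(lyndonFactors_spec w).2.2] at this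

theorem wordCoeff_piWord_self (q : k) (w : Word) : wordCoeff w (PiWord q w) = 1 := by
  have h := mem_wordSpan_iff.mp (hasLeadingWord_piWord q w) w (by simp [higherWords])
  rwa [map_sub, wordCoeff_word_self, sub_eq_zero] at h

theorem wordCoeff_piWord_eq_zero (q : k) {u w : Word} (hne : w ≠ u) (hw : w ∉ higherWords u) :
    wordCoeff w (PiWord q u) = 0 := by
  classical
  have h := mem_wordSpan_iff.mp (hasLeadingWord_piWord q u) w hw
  rwa [map_sub, wordCoeff_word, if_neg hne.symm, sub_zero] at h

end Triangularity

section Duality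

variable {k : Type*} [CommRing k] [Algebra ℚ k]

theorem wordCoeff_piWord_of_weight_ne (q : k) {u w : Word} (h : weight w ≠ weight u) :
    wordCoeff w (PiWord q u) = 0 :=
  wordCoeff_piWord_eq_zero q (fun hwu => h (by rw [hwu])) fun hw => h hw.1

theorem scal_piWord (q : k) (P : NCPoly k) (u : Word) :
    scal P (PiWord q u) = ∑ w ∈ (finite_weight_eq (weight u)).toFinset,
      wordCoeff w (PiWord q u) * wordCoeff w P := by
  classical
  have h : PiWord q u = ∑ w ∈ (finite_weight_eq (weight u)).toFinset,
      wordCoeff w (PiWord q u) • word k w := by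
    refine ncPoly_ext fun v => ?_
    simp only [map_sum, map_smul, wordCoeff_word, smul_eq_mul, mul_ite, mul_one, mul_zero]
    rw [Finset.sum_ite_eq']
    split_ifs with hv
    · rfl
    · exact wordCoeff_piWord_of_weight_ne q fun hv' => hv ((Set.Finite.mem_toFinset _).mpr hv')
  rw [scal_eq_scalBilin]
  conv_lhs => rw [h]
  simp only [map_sum, map_smul, ← scal_eq_scalBilin, scal_word_right, smul_eq_mul]

/-- The words of weight `n`. -/
abbrev WeightWord (n : ℕ) : Type := {w : Word // weight w = n}

noncomputable instance (n : ℕ) : Fintype (WeightWord n) := (finite_weight_eq n).fintype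

/-- The matrix of the coefficients of `Π` in weight `n`. -/
noncomputable def piMatrix (q : k) (n : ℕ) : Matrix (WeightWord n) (WeightWord n) k :=
  Matrix.of fun u w => wordCoeff w.1 (PiWord q u.1)

theorem isUnit_det_piMatrix (q : k) (n : ℕ) : IsUnit (piMatrix q n).det := by
  let f : WeightWord n → ℕ ×ₗ Word := fun w => toLex (w.1.length, w.1)
  have hf : Function.Injective f := fun a b h => by
    have := congrArg (fun x => (ofLex x).2) h
    exact Subtype.ext this
  let : LinearOrder (WeightWord n) := LinearOrder.lift' f hf
  have h := Matrix.det_of_isUpperTriangular (M := piMatrix q n) (by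
    intro u w hwu
    have hwu' : f w < f u := hwu
    refine wordCoeff_piWord_eq_zero q ?_ ?_
    · intro h
      rw [Subtype.ext h] at hwu'
      exact lt_irrefl _ hwu'
    · rintro ⟨-, h⟩
      exact lt_asymm hwu' (Prod.Lex.toLex_lt_toLex.mpr h))
  rw [h]
  simp [piMatrix, wordCoeff_piWord_self]

theorem scal_piWord_eq_sum (q : k) (P : NCPoly k) {n : ℕ} (u : WeightWord n) :
    scal P (PiWord q u.1) = ∑ w : WeightWord n, piMatrix q n u w * wordCoeff w.1 P := by
  obtain ⟨u, rfl⟩ := u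
  rw [scal_piWord]
  exact Finset.sum_subtype _ (fun w => Set.Finite.mem_toFinset _)
    fun w => wordCoeff w (PiWord q u) * wordCoeff w P

theorem eq_of_scal_piWord_eq (q : k) {P Q : NCPoly k}
    (h : ∀ u, scal P (PiWord q u) = scal Q (PiWord q u)) : P = Q := by
  refine ncPoly_ext fun w => ?_
  have hvec : (piMatrix q (weight w)).mulVec (fun v => wordCoeff v.1 P) =
      (piMatrix q (weight w)).mulVec (fun v => wordCoeff v.1 Q) := by
    ext u
    have := h u.1
    rwa [scal_piWord_eq_sum, scal_piWord_eq_sum] at this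
  have hinj := Matrix.mulVec_injective_of_isUnit
    ((Matrix.isUnit_iff_isUnit_det _).mpr (isUnit_det_piMatrix q (weight w)))
  exact congrFun (hinj hvec) ⟨w, rfl⟩

theorem exists_isDualToPi (q : k) : ∃ S, IsDualToPi q S := by
  classical
  refine ⟨fun v => ∑ w : WeightWord (weight v), (piMatrix q (weight v))⁻¹ w ⟨v, rfl⟩ •
    word k w.1, fun u v => ?_⟩
  simp only
  have hcoeff (w : Word) : wordCoeff w (∑ w : WeightWord (weight v),
      (piMatrix q (weight v))⁻¹ w ⟨v, rfl⟩ • word k w.1) =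
      if h : weight w = weight v then (piMatrix q (weight v))⁻¹ ⟨w, h⟩ ⟨v, rfl⟩ else 0 := by
    simp only [map_sum, map_smul, wordCoeff_word, smul_eq_mul, mul_ite, mul_one, mul_zero]
    split_ifs with h
    · rw [Finset.sum_eq_single_of_mem ⟨w, h⟩ (Finset.mem_univ _), if_pos rfl]
      intro x _ hx
      exact if_neg fun hxw => hx (Subtype.ext hxw)
    · exact Finset.sum_eq_zero fun x _ => if_neg fun hxw => h (by rw [← hxw, x.2])
  by_cases h : weight u = weight v
  · rw [scal_piWord_eq_sum q _ (⟨u, h⟩ : WeightWord (weight v))]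
    have h1 : (piMatrix q (weight v) * (piMatrix q (weight v))⁻¹) ⟨u, h⟩ ⟨v, rfl⟩ =
        if u = v then 1 else 0 := by
      rw [Matrix.mul_nonsing_inv _ (isUnit_det_piMatrix q _), Matrix.one_apply]
      exact if_congr Subtype.mk_eq_mk rfl rfl
    rw [← h1, Matrix.mul_apply]
    refine Finset.sum_congr rfl fun w _ => ?_
    rw [hcoeff, dif_pos w.2]
  · rw [scal_piWord, if_neg fun huv => h (by rw [huv])]
    refine Finset.sum_eq_zero fun w hw => ?_
    have hw' : weight w = weight u :=
      (Set.Finite.mem_toFinset (finite_weight_eq (weight u))).mp hw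
    rw [hcoeff, dif_neg (by rwa [hw']), mul_zero]

theorem isDualToPi_sigmaWord (q : k) : IsDualToPi q (SigmaWord q) :=
  Classical.epsilon_spec (exists_isDualToPi q)

theorem isDualToPi_iff (q : k) (S : Word → NCPoly k) : IsDualToPi q S ↔ S = SigmaWord q := by
  refine ⟨fun h => funext fun v => eq_of_scal_piWord_eq q fun u => ?_, ?_⟩
  · rw [h u v, isDualToPi_sigmaWord q u v]
  · rintro rfl
    exact isDualToPi_sigmaWord q

theorem sigmaWord_eq_of_forall (q : k) {v : Word} {P : NCPoly k}
    (h : ∀ u, scal P (PiWord q u) = if u = v then 1 else 0) : SigmaWord q v = P :=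
  eq_of_scal_piWord_eq q fun u => by rw [h u, isDualToPi_sigmaWord q u v]

theorem sigmaWord_nil (q : k) : SigmaWord q [] = 1 := by
  refine sigmaWord_eq_of_forall q fun u => ?_
  rw [← word_nil, scal_word_left]
  split_ifs with h
  · rw [h, wordCoeff_piWord_self]
  · refine wordCoeff_piWord_of_weight_ne q fun hw => h (eq_nil_of_weight_eq_zero ?_)
    rw [← hw, weight_nil]

theorem sigmaWord_letter (q : k) (c : Letter) : SigmaWord q [c] = word k [c] := by
  refine sigmaWord_eq_of_forall q fun u => ?_
  rw [scal_word_left]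
  split_ifs with h
  · rw [h, wordCoeff_piWord_self]
  · refine wordCoeff_piWord_eq_zero q (Ne.symm h) ?_
    rintro ⟨hw, hlen⟩
    have hc := letterIndex_pos c
    match u, hlen with
    | [], _ =>
      rw [weight_cons, weight_nil] at hw
      omega
    | [a], _ => exact h (by rw [weight_singleton_injective hw])
    | a :: b :: u, hlen => simp at hlen

end Duality

section Multiplicativity

/-- The list of the pairs of complementary sublists of a list. -/
def splits {α : Type*} : List α → List (List α × List α)
  | [] => [([], [])]
  | x :: L => (splits L).map (fun p => (x :: p.1, p.2)) ++ (splits L).map fun p => (p.1, x :: p.2)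

theorem perm_of_mem_splits {α : Type*} {L : List α} {p : List α × List α} (h : p ∈ splits L) :
    (p.1 ++ p.2).Perm L := by
  induction L generalizing p with
  | nil =>
    rw [splits, List.mem_singleton] at h
    rw [h]
    exact List.Perm.refl _
  | cons x L ih =>
    rw [splits, List.mem_append, List.mem_map, List.mem_map] at h
    rcases h with ⟨p, hp, rfl⟩ | ⟨p, hp, rfl⟩
    · exact (ih hp).cons x
    · exact List.perm_middle.trans ((ih hp).cons x)

theorem sublist_of_mem_splits {α : Type*} {L : List α} {p : List α × List α}
    (h : p ∈ splits L) : p.1.Sublist L ∧ p.2.Sublist L := by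
  induction L generalizing p with
  | nil =>
    rw [splits, List.mem_singleton] at h
    rw [h]
    exact ⟨List.Sublist.refl _, List.Sublist.refl _⟩
  | cons x L ih =>
    rw [splits, List.mem_append, List.mem_map, List.mem_map] at h
    rcases h with ⟨p, hp, rfl⟩ | ⟨p, hp, rfl⟩
    · exact ⟨(ih hp).1.cons_cons x, (ih hp).2.cons x⟩
    · exact ⟨(ih hp).1.cons x, (ih hp).2.cons_cons x⟩

section Count

variable {α : Type*} [DecidableEq α]

theorem count_splits_nil_left (B : List α) : (splits B).count ([], B) = 1 := by
  induction B with
  | nil => simp [splits]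
  | cons b B ih =>
    have hinj : Function.Injective fun p : List α × List α => (p.1, b :: p.2) := by
      rintro ⟨_, _⟩ ⟨_, _⟩ h
      simpa using h
    rw [splits, List.count_append, List.count_eq_zero_of_not_mem (by simp), zero_add]
    exact (List.count_map_of_injective _ _ hinj ([], B)).trans ih

theorem count_splits_cons (x : α) (A B L : List α) (hB : ∀ B', B ≠ x :: B') :
    (splits (x :: L)).count (x :: A, B) = (splits L).count (A, B) := by
  have hinj : Function.Injective fun p : List α × List α => (x :: p.1, p.2) := by
    rintro ⟨_, _⟩ ⟨_, _⟩ h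
    simpa using h
  have h0 : ((splits L).map fun p => (p.1, x :: p.2)).count (x :: A, B) = 0 := by
    refine List.count_eq_zero_of_not_mem ?_
    rw [List.mem_map]
    rintro ⟨p, _, hp⟩
    exact hB p.2 (congrArg Prod.snd hp).symm
  rw [splits, List.count_append, h0, add_zero]
  exact List.count_map_of_injective _ _ hinj (A, B)

theorem count_splits_cons_cons (x : α) (A B L : List α) :
    (splits (x :: L)).count (x :: A, x :: B) =
      (splits L).count (A, x :: B) + (splits L).count (x :: A, B) := by
  have hinj : Function.Injective fun p : List α × List α => (x :: p.1, p.2) := by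
    rintro ⟨_, _⟩ ⟨_, _⟩ h
    simpa using h
  have hinj' : Function.Injective fun p : List α × List α => (p.1, x :: p.2) := by
    rintro ⟨_, _⟩ ⟨_, _⟩ h
    simpa using h
  rw [splits, List.count_append]
  exact congrArg₂ _ (List.count_map_of_injective _ _ hinj (A, x :: B))
    (List.count_map_of_injective _ _ hinj' (x :: A, B))

theorem count_splits_replicate_append (l : α) (n : ℕ) {B : List α} (hB : l ∉ B) :
    (splits (List.replicate n l ++ B)).count (List.replicate n l, B) = 1 := by
  induction n with
  | zero => exact count_splits_nil_left B
  | succ n ih =>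
    rw [List.replicate_succ, List.cons_append, count_splits_cons, ih]
    rintro B' rfl
    simp at hB

theorem count_splits_replicate_succ (l : α) (n : ℕ) :
    (splits (List.replicate (n + 1) l)).count ([l], List.replicate n l) = n + 1 := by
  induction n with
  | zero => simp [splits]
  | succ n ih =>
    rw [List.replicate_succ, List.replicate_succ, count_splits_cons_cons, ← List.replicate_succ,
      count_splits_nil_left, ih, add_comm]

end Count

variable {k : Type*} [CommRing k]

theorem stuffle_smul_left (q r : k) (P Q : NCPoly k) :
    stuffle q (r • P) Q = r • stuffle q P Q := by
  rw [stuffle, stuffle, MonoidAlgebra.coeff_smul, Finsupp.sum_smul_index (by simp),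
    Finsupp.smul_sum]
  refine Finsupp.sum_congr fun u _ => ?_
  rw [Finsupp.smul_sum]
  refine Finsupp.sum_congr fun v _ => ?_
  rw [smul_smul, mul_assoc]

theorem stuffle_smul_right (q r : k) (P Q : NCPoly k) :
    stuffle q P (r • Q) = r • stuffle q P Q := by
  rw [stuffle, stuffle, Finsupp.smul_sum]
  refine Finsupp.sum_congr fun u _ => ?_
  rw [MonoidAlgebra.coeff_smul, Finsupp.sum_smul_index (by simp), Finsupp.smul_sum]
  refine Finsupp.sum_congr fun v _ => ?_
  rw [smul_smul]
  congr 1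
  ring

theorem stufflePow_succ (q : k) (P : NCPoly k) (n : ℕ) :
    stufflePow q P (n + 1) = stuffle q P (stufflePow q P n) := rfl

variable [Algebra ℚ k]

theorem piWord_flatten (q : k) {L : List Word} (hL : ∀ u ∈ L, IsLyndon u)
    (hc : L.Pairwise (· ≥ ·)) : PiWord q L.flatten = (L.map (PiLyndon q)).prod := by
  rw [PiWord, lyndonFactors_flatten hL hc]

theorem coproduct_prod_piLyndon (q : k) {L : List Word} (hL : ∀ u ∈ L, IsLyndon u) :
    coproduct q (L.map (PiLyndon q)).prod = ((splits L).map fun p =>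
      tensorLeft k (p.1.map (PiLyndon q)).prod *
        tensorRight k (p.2.map (PiLyndon q)).prod).sum := by
  induction L with
  | nil => simp [splits]
  | cons x L ih =>
    have hx : coproduct q (PiLyndon q x) = _ := isPrimitive_piLyndon q x (hL x (by simp))
    rw [List.map_cons, List.prod_cons, map_mul, hx, ih fun u hu => hL u (by simp [hu]), add_mul,
      splits, List.map_append, List.sum_append, ← List.sum_map_mul_left, ← List.sum_map_mul_left,
      List.map_map, List.map_map]
    congr 3
    · funext p
      simp only [Function.comp_apply, List.map_cons, List.prod_cons, map_mul, mul_assoc]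
    · funext p
      simp only [Function.comp_apply, List.map_cons, List.prod_cons, map_mul, ← mul_assoc,
        tensorLeft_mul_tensorRight_comm]

theorem scal_sigmaWord_prod (q : k) {A L : List Word} (hA : ∀ u ∈ A, IsLyndon u)
    (hAc : A.Pairwise (· ≥ ·)) (hL : ∀ u ∈ L, IsLyndon u) (hLc : L.Pairwise (· ≥ ·)) :
    scal (SigmaWord q A.flatten) (L.map (PiLyndon q)).prod = if L = A then 1 else 0 := by
  rw [← piWord_flatten q hL hLc, isDualToPi_sigmaWord q]
  refine if_congr ⟨fun h => eq_of_flatten_eq hL hA hLc hAc h, fun h => by rw [h]⟩ rfl rfl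

theorem scal_stuffle_sigmaWord (q : k) {A B L : List Word} (hA : ∀ u ∈ A, IsLyndon u)
    (hAc : A.Pairwise (· ≥ ·)) (hB : ∀ u ∈ B, IsLyndon u) (hBc : B.Pairwise (· ≥ ·))
    (hL : ∀ u ∈ L, IsLyndon u) (hLc : L.Pairwise (· ≥ ·)) :
    scal (stuffle q (SigmaWord q A.flatten) (SigmaWord q B.flatten)) (L.map (PiLyndon q)).prod =
      (splits L).count (A, B) := by
  rw [scal_stuffle, coproduct_prod_piLyndon q hL, map_list_sum, List.map_map]
  have hsum : ∀ M : List (List Word × List Word), (M.map fun p : List Word × List Word =>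
      if p = (A, B) then (1 : k) else 0).sum = M.count (A, B) := by
    intro M
    induction M with
    | nil => simp
    | cons p M ih =>
      rw [List.map_cons, List.sum_cons, ih, List.count_cons]
      by_cases h : p = (A, B) <;> simp [h, add_comm]
  rw [← hsum]
  refine congrArg List.sum (List.map_congr_left fun p hp => ?_)
  obtain ⟨h1, h2⟩ := sublist_of_mem_splits hp
  rw [Function.comp_apply, tensorScal_tensorLeft_mul_tensorRight,
    scal_sigmaWord_prod q hA hAc (fun u hu => hL u (h1.subset hu)) (hLc.sublist h1),
    scal_sigmaWord_prod q hB hBc (fun u hu => hL u (h2.subset hu)) (hLc.sublist h2),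
    if_congr (Prod.ext_iff (x := p) (y := (A, B))) rfl rfl, ite_and, ite_mul, one_mul, zero_mul]

/-- The `q`-stuffle product of two elements of the dual basis. -/
theorem stuffle_sigmaWord (q : k) {A B M : List Word} (hM : ∀ u ∈ M, IsLyndon u)
    (hMc : M.Pairwise (· ≥ ·)) (hAc : A.Pairwise (· ≥ ·)) (hBc : B.Pairwise (· ≥ ·))
    (hperm : (A ++ B).Perm M) :
    stuffle q (SigmaWord q A.flatten) (SigmaWord q B.flatten) =
      ((splits M).count (A, B) : k) • SigmaWord q M.flatten := by
  have hA : ∀ u ∈ A, IsLyndon u := fun u hu => hM u (hperm.subset (by simp [hu]))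
  have hB : ∀ u ∈ B, IsLyndon u := fun u hu => hM u (hperm.subset (by simp [hu]))
  refine eq_of_scal_piWord_eq q fun u => ?_
  obtain ⟨hL, -, hu⟩ := lyndonFactors_spec u
  have hLc := lyndonFactors_pairwise u
  generalize lyndonFactors u = L at *
  subst hu
  rw [piWord_flatten q hL hLc, scal_stuffle_sigmaWord q hA hAc hB hBc hL hLc, scal_eq_scalBilin,
    map_smul, LinearMap.smul_apply, ← scal_eq_scalBilin, scal_sigmaWord_prod q hM hMc hL hLc,
    smul_eq_mul, mul_ite, mul_one, mul_zero]
  split_ifs with h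
  · rw [h]
  · rw [List.count_eq_zero_of_not_mem, Nat.cast_zero]
    intro hmem
    refine h (List.Perm.eq_of_pairwise (fun a b _ _ h1 h2 => le_antisymm h2 h1) hLc hMc ?_)
    exact (perm_of_mem_splits hmem).symm.trans hperm

theorem stufflePow_sigmaWord (q : k) {l : Word} (hl : IsLyndon l) (n : ℕ) :
    stufflePow q (SigmaWord q l) n =
      (n.factorial : k) • SigmaWord q (List.replicate n l).flatten := by
  induction n with
  | zero =>
    rw [List.replicate_zero, List.flatten_nil, sigmaWord_nil, Nat.factorial_zero, Nat.cast_one,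
      one_smul]
    rfl
  | succ n ih =>
    have hpw (m : ℕ) : (List.replicate m l).Pairwise (· ≥ ·) := by
      simp [List.pairwise_replicate]
    have h := stuffle_sigmaWord q (A := [l]) (B := List.replicate n l)
      (M := List.replicate (n + 1) l)
      (fun u hu => by rwa [List.eq_of_mem_replicate hu]) (hpw _) (hpw 1) (hpw _)
      (List.Perm.refl _)
    rw [show List.count _ _ = n + 1 by convert count_splits_replicate_succ l n,
      List.flatten_singleton] at h
    rw [stufflePow_succ, ih, stuffle_smul_right, h, smul_smul, Nat.factorial_succ, mul_comm]
    push_cast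
    rfl

theorem stuffleList_stufflePow_sigmaWord (q : k) {Q : List (Word × ℕ)}
    (hQ : ∀ p ∈ Q, IsLyndon p.1) (hc : Q.Pairwise fun p p' => p'.1 < p.1) :
    stuffleList q (Q.map fun p => stufflePow q (SigmaWord q p.1) p.2) =
      (((Q.map fun p => p.2.factorial).prod : ℕ) : k) •
        SigmaWord q (Q.flatMap fun p => List.replicate p.2 p.1).flatten := by
  have hmem {Q : List (Word × ℕ)} {u : Word}
      (hu : u ∈ Q.flatMap fun p => List.replicate p.2 p.1) : ∃ p ∈ Q, u = p.1 := by
    obtain ⟨p, hp, hup⟩ := List.mem_flatMap.mp hu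
    exact ⟨p, hp, List.eq_of_mem_replicate hup⟩
  have hsort {Q : List (Word × ℕ)} (hc : Q.Pairwise fun p p' => p'.1 < p.1) :
      (Q.flatMap fun p => List.replicate p.2 p.1).Pairwise (· ≥ ·) := by
    rw [List.pairwise_flatMap]
    refine ⟨fun p _ => by simp [List.pairwise_replicate], hc.imp fun {p p'} h x hx y hy => ?_⟩
    rw [List.eq_of_mem_replicate hx, List.eq_of_mem_replicate hy]
    exact h.le
  induction Q with
  | nil =>
    simp only [List.map_nil, List.prod_nil, List.flatMap_nil, List.flatten_nil, sigmaWord_nil,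
      Nat.cast_one, one_smul]
    rfl
  | cons p Q ih =>
    have hc' := List.pairwise_cons.mp hc
    rw [List.map_cons, stuffleList_cons, ih (fun p hp => hQ p (by simp [hp])) hc'.2,
      stufflePow_sigmaWord q (hQ p (by simp)), stuffle_smul_left, stuffle_smul_right,
      stuffle_sigmaWord q (M := (p :: Q).flatMap fun p => List.replicate p.2 p.1) ?_ (hsort hc)
        (by simp [List.pairwise_replicate]) (hsort hc'.2) (List.Perm.refl _)]
    · have hp : p.1 ∉ Q.flatMap fun p => List.replicate p.2 p.1 := by
        intro h
        obtain ⟨p', hp', h⟩ := hmem h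
        exact (hc'.1 p' hp').ne h.symm
      rw [List.flatMap_cons, show List.count _ _ = 1 by
        convert count_splits_replicate_append p.1 p.2 hp, Nat.cast_one, one_smul, smul_smul,
        List.map_cons, List.prod_cons, Nat.cast_mul]
    · intro u hu
      obtain ⟨p', hp', rfl⟩ := hmem hu
      exact hQ p' hp'

end Multiplicativity

theorem mainTheorem2 {k : Type*} [CommRing k] [Algebra ℚ k] (q : k) :
    (∀ S : Word → NCPoly k, IsDualToPi q S ↔ S = SigmaWord q) ∧
    SigmaWord q [] = 1 ∧
    (∀ (m : ℕ) (l : Fin m → Word) (i : Fin m → ℕ),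
      (∀ j, IsLyndon (l j)) → StrictAnti l → (∀ j, 1 ≤ i j) →
      SigmaWord q (List.ofFn fun j => (List.replicate (i j) (l j)).flatten).flatten =
        ((∏ j, ((i j).factorial : ℚ))⁻¹) •
          stuffleList q (List.ofFn fun j => stufflePow q (SigmaWord q (l j)) (i j))) ∧
    (∀ s : ℕ+, SigmaWord q [letterY s] = word k [letterY s] ∧
      word k [letterY s] = piCheck1 q (word k [letterY s])) := by
  refine ⟨isDualToPi_iff q, sigmaWord_nil q, fun m l i hl hanti _ => ?_,
    fun s => ⟨sigmaWord_letter q _, (piCheck1_letter q _).symm⟩⟩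
  have h := stuffleList_stufflePow_sigmaWord q (Q := List.ofFn fun j => (l j, i j))
    (by
      intro p hp
      obtain ⟨j, rfl⟩ := List.mem_ofFn.mp hp
      exact hl j)
    (List.pairwise_ofFn.mpr fun _ _ hab => hanti hab)
  have hflat : ∀ Q : List (Word × ℕ), (Q.flatMap fun p => List.replicate p.2 p.1).flatten =
      (Q.map fun p => (List.replicate p.2 p.1).flatten).flatten := by
    intro Q
    induction Q with
    | nil => rfl
    | cons p Q ih => simp [ih]
  rw [hflat, List.map_ofFn, List.map_ofFn, List.map_ofFn] at h
  simp only [Function.comp_def, List.prod_ofFn] at h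
  rw [h]
  have hne : (∏ j, ((i j).factorial : ℚ)) ≠ 0 :=
    Finset.prod_ne_zero_iff.mpr fun j _ => Nat.cast_ne_zero.mpr (Nat.factorial_ne_zero _)
  have hcast : ((∏ j, (i j).factorial : ℕ) : k) = algebraMap ℚ k (∏ j, ((i j).factorial : ℚ)) := by
    simp
  rw [hcast, algebraMap_smul, smul_smul, inv_mul_cancel₀ hne, one_smul]
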